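/- Let $k$ be a field, let $q\in k$ be nonzero and not a root of unity, and let $n\ge 0$ be an integer. Let $\mathcal O_q(M_n(k))$ be the $k$-algebra with generators $X_{ij}$ ($1\le i,j\le n$) and relations $$X_{ij}X_{lj}=qX_{lj}X_{ij}\ (i<l),\qquad X_{ij}X_{im}=qX_{im}X_{ij}\ (j<m),$$ $$X_{ij}X_{lm}=X_{lm}X_{ij}\ (i<l,\ j>m),\qquad X_{ij}X_{lm}-X_{lm}X_{ij}=(q-q^{-1})X_{im}X_{lj}\ (i<l,\ j<m).$$ Let $D_q=\sum_{\sigma\in S_n}(-q)^{\ell(\sigma)}X_{1,\sigma(1)}\cdots X_{n,\sigma(n)}$ be the quantum determinant, where $\ell(\sigma)$ is the minimal length of an expression for $\sigma$ as a product of simple transpositions $(i,i+1)$, let $\mathcal O_q(SL_n(k))=\mathcal O_q(M_n(k))/\langle D_q-1\rangle$, and let $\pi:\mathcal O_q(M_n(k))\to\mathcal O_q(SL_n(k))$ be the quotient map. The torus $H=(k^\times)^{2n}$ acts on $\mathcal O_q(M_n(k))$ by $k$-algebra automorphisms with $(\alpha_1,\dots,\alpha_n,\beta_1,\dots,\beta_n).X_{ij}=\alpha_i\beta_jX_{ij}$,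 and the subgroup $SH=\{(\alpha,\beta)\in H\mid \alpha_1\cdots\alpha_n\beta_1\cdots\beta_n=1\}$, which fixes $D_q$, acts on $\mathcal O_q(SL_n(k))$ by the induced automorphisms. All ideals are two-sided. An ideal $P$ is prime if it is proper and $IJ\subseteq P$ implies $I\subseteq P$ or $J\subseteq P$ for all ideals $I,J$. For a group $G$ acting on an algebra by automorphisms, an ideal $P$ is $G$-prime if it is proper and $G$-stable and $IJ\subseteq P$ implies $I\subseteq P$ or $J\subseteq P$ for all $G$-stable ideals $I,J$. Then the map $P\mapsto\pi(P)$ is a bijection $$\{P \text{ an } H\text{-prime ideal of } \mathcal O_q(M_n(k))\mid D_q\notin P\}\longrightarrow\{SH\text{-prime ideals of }\mathcal O_q(SL_n(k))\}.$$ The same map is also a bijection from the set of $H$-stable prime ideals of $\mathcal O_q(M_n(k))$ not containing $D_q$ onto the set of $SH$-stable prime ideals of $\mathcal O_q(SL_n(k))$. -/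

import Mathlib

noncomputable section

namespace QuantumMatrix

/-! ### The quantized coordinate ring of `n × n` matrices -/

/-- The defining relations of `O_q(M_n(k))` on the free algebra on the symbols `X_{ij}`. -/
inductive Rel {k : Type*} [Field k] (q : k) (n : ℕ) :
    FreeAlgebra k (Fin n × Fin n) → FreeAlgebra k (Fin n × Fin n) → Prop
  | col (i l j : Fin n) (h : i < l) :
      Rel q n (FreeAlgebra.ι k (i, j) * FreeAlgebra.ι k (l, j))
        (q • (FreeAlgebra.ι k (l, j) * FreeAlgebra.ι k (i, j)))
  | row (i j m : Fin n) (h : j < m) :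
      Rel q n (FreeAlgebra.ι k (i, j) * FreeAlgebra.ι k (i, m))
        (q • (FreeAlgebra.ι k (i, m) * FreeAlgebra.ι k (i, j)))
  | anti (i l j m : Fin n) (h : i < l) (h' : m < j) :
      Rel q n (FreeAlgebra.ι k (i, j) * FreeAlgebra.ι k (l, m))
        (FreeAlgebra.ι k (l, m) * FreeAlgebra.ι k (i, j))
  | diag (i l j m : Fin n) (h : i < l) (h' : j < m) :
      Rel q n (FreeAlgebra.ι k (i, j) * FreeAlgebra.ι k (l, m)
          - FreeAlgebra.ι k (l, m) * FreeAlgebra.ι k (i, j))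
        ((q - q⁻¹) • (FreeAlgebra.ι k (i, m) * FreeAlgebra.ι k (l, j)))

/-- `O_q(M_n(k))`. -/
def OqM {k : Type*} [Field k] (q : k) (n : ℕ) : Type _ := RingQuot (Rel q n)

instance {k : Type*} [Field k] (q : k) (n : ℕ) : Ring (OqM q n) :=
  inferInstanceAs (Ring (RingQuot (Rel q n)))

instance {k : Type*} [Field k] (q : k) (n : ℕ) : Algebra k (OqM q n) :=
  inferInstanceAs (Algebra k (RingQuot (Rel q n)))

/-- The presentation map from the free algebra. -/
def ofFree {k : Type*} [Field k] (q : k) (n : ℕ) :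
    FreeAlgebra k (Fin n × Fin n) →ₐ[k] OqM q n :=
  RingQuot.mkAlgHom k (Rel q n)

theorem ofFree_rel {k : Type*} [Field k] (q : k) (n : ℕ)
    {x y : FreeAlgebra k (Fin n × Fin n)} (h : Rel q n x y) : ofFree q n x = ofFree q n y :=
  RingQuot.mkAlgHom_rel k h

/-- The generator `X_{ij}` of `O_q(M_n(k))`. -/
def X {k : Type*} [Field k] (q : k) (n : ℕ) (i j : Fin n) : OqM q n :=
  ofFree q n (FreeAlgebra.ι k (i, j))

/-- The length of a permutation: the minimal length of an expression as a product of simple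
transpositions `(i, i+1)`. -/
def permLength {n : ℕ} (σ : Equiv.Perm (Fin n)) : ℕ :=
  sInf {m : ℕ | ∃ l : List (Equiv.Perm (Fin n)),
    (∀ s ∈ l, ∃ i j : Fin n, (j : ℕ) = (i : ℕ) + 1 ∧ s = Equiv.swap i j) ∧
    l.prod = σ ∧ l.length = m}

/-- The quantum determinant
`D_q = ∑_σ (-q)^{ℓ(σ)} X_{1,σ(1)} X_{2,σ(2)} ⋯ X_{n,σ(n)}` (the product in this order). -/
def qdet {k : Type*} [Field k] (q : k) (n : ℕ) : OqM q n :=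
  ∑ σ : Equiv.Perm (Fin n),
    (-q) ^ permLength σ • (List.ofFn fun i : Fin n => X q n i (σ i)).prod

/-- `O_q(SL_n(k)) = O_q(M_n(k)) / ⟨D_q - 1⟩`. -/
def OqSL {k : Type*} [Field k] (q : k) (n : ℕ) : Type _ :=
  (TwoSidedIdeal.span {qdet q n - 1}).ringCon.Quotient

instance {k : Type*} [Field k] (q : k) (n : ℕ) : Ring (OqSL q n) :=
  inferInstanceAs (Ring (TwoSidedIdeal.span {qdet q n - 1}).ringCon.Quotient)

instance {k : Type*} [Field k] (q : k) (n : ℕ) : Algebra k (OqSL q n) :=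
  inferInstanceAs (Algebra k (TwoSidedIdeal.span {qdet q n - 1}).ringCon.Quotient)

/-- The quotient map `π : O_q(M_n(k)) → O_q(SL_n(k))`. -/
def quotMap {k : Type*} [Field k] (q : k) (n : ℕ) : OqM q n →ₐ[k] OqSL q n :=
  (TwoSidedIdeal.span {qdet q n - 1}).ringCon.mkₐ k

theorem quotMap_surjective {k : Type*} [Field k] (q : k) (n : ℕ) :
    Function.Surjective (quotMap q n) :=
  RingCon.mkₐ_surjective _

/-! ### The torus actions -/

/-- The torus `H = (kˣ)^{2n}`, with elements `(α, β)`. -/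
abbrev Torus (k : Type*) [Field k] (n : ℕ) : Type _ := (Fin n → kˣ) × (Fin n → kˣ)

/-- The subgroup `SH` of those `(α, β) ∈ H` with `α₁ ⋯ αₙ β₁ ⋯ βₙ = 1`. -/
def specialTorus (k : Type*) [Field k] (n : ℕ) : Subgroup (Torus k n) where
  carrier := {h | (∏ i, h.1 i) * (∏ j, h.2 j) = 1}
  one_mem' := by simp
  mul_mem' := by
    intro a b ha hb
    simp only [Set.mem_ofPred_eq, Prod.fst_mul, Prod.snd_mul, Pi.mul_apply,
      Finset.prod_mul_distrib] at *
    rw [mul_mul_mul_comm, ha, hb, one_mul]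
  inv_mem' := by
    intro a ha
    simp only [Set.mem_ofPred_eq, Prod.fst_inv, Prod.snd_inv, Pi.inv_apply,
      Finset.prod_inv_distrib] at *
    rw [← mul_inv, ha, inv_one]

theorem X_col {k : Type*} [Field k] (q : k) (n : ℕ) {i l : Fin n} (j : Fin n) (h : i < l) :
    X q n i j * X q n l j = q • (X q n l j * X q n i j) := by
  simpa [X] using ofFree_rel q n (Rel.col (q := q) i l j h)

theorem X_row {k : Type*} [Field k] (q : k) (n : ℕ) (i : Fin n) {j m : Fin n} (h : j < m) :
    X q n i j * X q n i m = q • (X q n i m * X q n i j) := by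
  simpa [X] using ofFree_rel q n (Rel.row (q := q) i j m h)

theorem X_anti {k : Type*} [Field k] (q : k) (n : ℕ) {i l j m : Fin n} (h : i < l)
    (h' : m < j) : X q n i j * X q n l m = X q n l m * X q n i j := by
  simpa [X] using ofFree_rel q n (Rel.anti (q := q) i l j m h h')

theorem X_diag {k : Type*} [Field k] (q : k) (n : ℕ) {i l j m : Fin n} (h : i < l)
    (h' : j < m) : X q n i j * X q n l m - X q n l m * X q n i j
      = (q - q⁻¹) • (X q n i m * X q n l j) := by
  simpa only [X, map_sub, map_mul, map_smul] using
    ofFree_rel q n (Rel.diag (q := q) i l j m h h')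

/-- The algebra endomorphism `X_{ij} ↦ α_i β_j X_{ij}` of `O_q(M_n(k))`. -/
def torusHom {k : Type*} [Field k] (q : k) (n : ℕ) (h : Torus k n) : OqM q n →ₐ[k] OqM q n :=
  RingQuot.liftAlgHom k
    ⟨FreeAlgebra.lift k fun p => ((h.1 p.1 : k) * (h.2 p.2 : k)) • X q n p.1 p.2, by
      intro x y hxy
      induction hxy with
      | col i l j hil =>
        simp only [map_mul, map_smul, FreeAlgebra.lift_ι_apply, smul_mul_smul_comm,
          X_col q n j hil]
        rw [smul_comm q, mul_comm (_ * _ : k)]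
      | row i j m hjm =>
        simp only [map_mul, map_smul, FreeAlgebra.lift_ι_apply, smul_mul_smul_comm,
          X_row q n i hjm]
        rw [smul_comm q, mul_comm (_ * _ : k)]
      | anti i l j m hil hmj =>
        simp only [map_mul, FreeAlgebra.lift_ι_apply, smul_mul_smul_comm, X_anti q n hil hmj]
        rw [mul_comm (_ * _ : k)]
      | diag i l j m hil hjm =>
        simp only [map_mul, map_sub, map_smul, FreeAlgebra.lift_ι_apply, smul_mul_smul_comm]
        rw [mul_comm ((h.1 l : k) * _), ← smul_sub, X_diag q n hil hjm, smul_smul, smul_smul]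
        congr 1
        ring⟩

theorem torusHom_X {k : Type*} [Field k] (q : k) (n : ℕ) (h : Torus k n) (i j : Fin n) :
    torusHom q n h (X q n i j) = ((h.1 i : k) * (h.2 j : k)) • X q n i j := by
  exact (RingQuot.liftAlgHom_mkAlgHom_apply k _ _ _).trans (FreeAlgebra.lift_ι_apply _ _)

theorem OqM_hom_ext {k : Type*} [Field k] (q : k) (n : ℕ) {B : Type*} [Ring B] [Algebra k B]
    {f g : OqM q n →ₐ[k] B} (hfg : ∀ i j, f (X q n i j) = g (X q n i j)) : f = g := by
  apply RingQuot.ringQuot_ext'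
  ext p
  exact hfg p.1 p.2

/-- The action of `H` on `O_q(M_n(k))` by `k`-algebra automorphisms,
`(α, β) . X_{ij} = α_i β_j X_{ij}`. -/
def torusAction {k : Type*} [Field k] (q : k) (n : ℕ) :
    Torus k n →* (OqM q n ≃ₐ[k] OqM q n) where
  toFun h := AlgEquiv.ofAlgHom (torusHom q n h) (torusHom q n h⁻¹)
    (OqM_hom_ext q n fun i j => by
      simp [torusHom_X, smul_smul, mul_mul_mul_comm])
    (OqM_hom_ext q n fun i j => by
      simp [torusHom_X, smul_smul, mul_mul_mul_comm])
  map_one' := by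
    apply AlgEquiv.coe_toAlgHom_injective
    exact OqM_hom_ext q n fun i j => by simp [torusHom_X]
  map_mul' g h := by
    apply AlgEquiv.coe_toAlgHom_injective
    exact OqM_hom_ext q n fun i j => by
      simp only [torusHom_X, AlgEquiv.coe_toAlgHom, AlgEquiv.mul_apply,
        AlgEquiv.ofAlgHom_apply, map_smul, smul_smul, Prod.fst_mul, Prod.snd_mul,
        Pi.mul_apply, Units.val_mul]
      congr 1
      ring

theorem torusAction_X {k : Type*} [Field k] (q : k) (n : ℕ) (h : Torus k n) (i j : Fin n) :
    torusAction q n h (X q n i j) = ((h.1 i : k) * (h.2 j : k)) • X q n i j :=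
  torusHom_X q n h i j

theorem ofFn_smul_prod {k A : Type*} [Field k] [Ring A] [Algebra k A] {n : ℕ} (c : Fin n → k)
    (x : Fin n → A) :
    (List.ofFn fun i => c i • x i).prod = (∏ i, c i) • (List.ofFn x).prod := by
  induction n with
  | zero => simp
  | succ n ih =>
    rw [List.ofFn_succ, List.prod_cons, ih, List.ofFn_succ, List.prod_cons, Fin.prod_univ_succ,
      smul_mul_smul_comm]

theorem torusAction_qdet {k : Type*} [Field k] (q : k) (n : ℕ) (h : Torus k n) :
    torusAction q n h (qdet q n)
      = ((((∏ i, h.1 i) * (∏ j, h.2 j) : kˣ)) : k) • qdet q n := by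
  simp only [qdet, map_sum, map_smul, map_list_prod, List.map_ofFn, Finset.smul_sum]
  refine Finset.sum_congr rfl fun σ _ => ?_
  have : (⇑(torusAction q n h) ∘ fun i => X q n i (σ i))
      = fun i => ((h.1 i : k) * (h.2 (σ i) : k)) • X q n i (σ i) := by
    funext i
    exact torusAction_X q n h i (σ i)
  rw [this, ofFn_smul_prod, Finset.prod_mul_distrib, Equiv.prod_comp σ fun j => (h.2 j : k),
    smul_comm]
  simp

/-- The endomorphism of `O_q(SL_n(k))` induced by an element of `SH`. -/
def slTorusHom {k : Type*} [Field k] (q : k) (n : ℕ) (h : specialTorus k n) :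
    OqSL q n →ₐ[k] OqSL q n :=
  RingCon.liftₐ _ ((quotMap q n).comp (torusAction q n (h : Torus k n) : OqM q n →ₐ[k] OqM q n))
    (by
      let f : OqM q n →ₐ[k] OqSL q n :=
        (quotMap q n).comp (torusAction q n (h : Torus k n) : OqM q n →ₐ[k] OqM q n)
      have hle : TwoSidedIdeal.span {qdet q n - 1} ≤ TwoSidedIdeal.ker (f : OqM q n →+* OqSL q n) := by
        rw [TwoSidedIdeal.span_le, Set.singleton_subset_iff, SetLike.mem_coe,
          TwoSidedIdeal.mem_ker]
        have h1 : torusAction q n (h : Torus k n) (qdet q n - 1) = qdet q n - 1 := by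
          have h2 : (∏ i, (h : Torus k n).1 i) * (∏ j, (h : Torus k n).2 j) = 1 := h.2
          rw [map_sub, torusAction_qdet, h2, map_one, Units.val_one, one_smul]
        change quotMap q n (torusAction q n (h : Torus k n) (qdet q n - 1)) = 0
        rw [h1]
        have h3 : qdet q n - 1 ∈ TwoSidedIdeal.span {qdet q n - 1} :=
          TwoSidedIdeal.subset_span rfl
        exact Quotient.sound h3
      intro x y hxy
      have hmem := hle ((TwoSidedIdeal.rel_iff _ x y).1 hxy)
      rw [TwoSidedIdeal.mem_ker, map_sub, sub_eq_zero] at hmem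
      exact hmem)

theorem slTorusHom_quotMap {k : Type*} [Field k] (q : k) (n : ℕ) (h : specialTorus k n)
    (a : OqM q n) :
    slTorusHom q n h (quotMap q n a) = quotMap q n (torusAction q n (h : Torus k n) a) :=
  rfl

/-- The induced action of `SH` on `O_q(SL_n(k))` by `k`-algebra automorphisms,
`h . π(a) = π(h . a)`. -/
def slTorusAction {k : Type*} [Field k] (q : k) (n : ℕ) :
    specialTorus k n →* (OqSL q n ≃ₐ[k] OqSL q n) where
  toFun h := AlgEquiv.ofAlgHom (slTorusHom q n h) (slTorusHom q n h⁻¹)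
    (AlgHom.ext fun b => by
      obtain ⟨a, rfl⟩ := quotMap_surjective q n b
      simp only [AlgHom.comp_apply, slTorusHom_quotMap, ← AlgEquiv.mul_apply, ← map_mul,
        ← Subgroup.coe_mul, mul_inv_cancel]
      simp)
    (AlgHom.ext fun b => by
      obtain ⟨a, rfl⟩ := quotMap_surjective q n b
      simp only [AlgHom.comp_apply, slTorusHom_quotMap, ← AlgEquiv.mul_apply, ← map_mul,
        ← Subgroup.coe_mul, inv_mul_cancel]
      simp)
  map_one' := by
    ext b
    obtain ⟨a, rfl⟩ := quotMap_surjective q n b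
    simp [slTorusHom_quotMap]
  map_mul' g h := by
    ext b
    obtain ⟨a, rfl⟩ := quotMap_surjective q n b
    simp [slTorusHom_quotMap]

theorem slTorusAction_quotMap {k : Type*} [Field k] (q : k) (n : ℕ) (h : specialTorus k n)
    (a : OqM q n) :
    slTorusAction q n h (quotMap q n a) = quotMap q n (torusAction q n (h : Torus k n) a) :=
  rfl

/-! ### Prime ideals, stable ideals and `G`-prime ideals -/

/-- A two-sided ideal `P` of a (noncommutative) ring is prime if it is proper and, for all
two-sided ideals `I`, `J`, `I J ⊆ P` implies `I ⊆ P` or `J ⊆ P`. -/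
def IsPrimeIdeal {A : Type*} [Ring A] (P : TwoSidedIdeal A) : Prop :=
  P ≠ ⊤ ∧ ∀ I J : TwoSidedIdeal A, (∀ a ∈ I, ∀ b ∈ J, a * b ∈ P) → I ≤ P ∨ J ≤ P

/-- A two-sided ideal stable under an action of a group `G` by algebra automorphisms. -/
def IsStable {k A G : Type*} [Field k] [Ring A] [Algebra k A] [Group G]
    (φ : G →* (A ≃ₐ[k] A)) (I : TwoSidedIdeal A) : Prop :=
  ∀ g : G, ∀ a ∈ I, φ g a ∈ I

/-- A `G`-prime ideal: a proper `G`-stable ideal `P` such that, for all `G`-stable ideals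
`I`, `J`, `I J ⊆ P` implies `I ⊆ P` or `J ⊆ P`. -/
def IsGPrime {k A G : Type*} [Field k] [Ring A] [Algebra k A] [Group G]
    (φ : G →* (A ≃ₐ[k] A)) (P : TwoSidedIdeal A) : Prop :=
  P ≠ ⊤ ∧ IsStable φ P ∧ ∀ I J : TwoSidedIdeal A, IsStable φ I → IsStable φ J →
    (∀ a ∈ I, ∀ b ∈ J, a * b ∈ P) → I ≤ P ∨ J ≤ P

/-- The set-theoretic image `π(P)` of an ideal under `π : O_q(M_n(k)) → O_q(SL_n(k))`; it is an
ideal because `π` is surjective. -/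
def imageIdeal {k : Type*} [Field k] (q : k) (n : ℕ) (P : TwoSidedIdeal (OqM q n)) :
    TwoSidedIdeal (OqSL q n) :=
  TwoSidedIdeal.mk' (quotMap q n '' (P : Set (OqM q n)))
    ⟨0, P.zero_mem, map_zero _⟩
    (by
      rintro _ _ ⟨a, ha, rfl⟩ ⟨b, hb, rfl⟩
      exact ⟨a + b, P.add_mem ha hb, map_add _ _ _⟩)
    (by
      rintro _ ⟨a, ha, rfl⟩
      exact ⟨-a, P.neg_mem ha, map_neg _ _⟩)
    (by
      rintro x _ ⟨a, ha, rfl⟩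
      obtain ⟨c, rfl⟩ := quotMap_surjective q n x
      exact ⟨c * a, P.mul_mem_left _ _ ha, map_mul _ _ _⟩)
    (by
      rintro _ y ⟨a, ha, rfl⟩
      obtain ⟨c, rfl⟩ := quotMap_surjective q n y
      exact ⟨a * c, P.mul_mem_right _ _ ha, map_mul _ _ _⟩)

theorem mem_imageIdeal {k : Type*} [Field k] (q : k) (n : ℕ) (P : TwoSidedIdeal (OqM q n))
    (x : OqSL q n) : x ∈ imageIdeal q n P ↔ ∃ a ∈ P, quotMap q n a = x :=
  TwoSidedIdeal.mem_mk' _ _ _ _ _ _ x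

end QuantumMatrix

end

/-! Passing to the quotient by `D_q - 1` is dehomogenization, and its inverse is homogenization.
Grade `O_q(M_n)` by the degree in the generators of the first row. Each monomial of `D_q` has
exactly one factor from that row, so `D_q` is homogeneous of degree one (total degree would give
degree `n`, and powers of `D_q` could then not bring all components into one degree). It is also
central.

An `H`-stable ideal is homogeneous: rescaling the first row by `q` acts on degree `m` by `q ^ m`,
and these scalars are distinct because `q` is not a root of unity. To an ideal `Q` of `O_q(SL_n)`
corresponds `liftIdeal`, made of the elements all of whose components map into `Q`. Its image is
`Q`, since each element has the same image as some homogeneous one. Conversely, let `P` be `H`-prime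
with `D_q ∉ P`. Then `D_q` is regular modulo `P`, and a homogeneous `a` with `a - p = (D_q - 1) c`,
`p ∈ P`, lies in `P`: homogenizing in a large degree kills the right side and leaves a power of
`D_q` times `a` in `P` (`Grading.mem_of_sub_mem`).

Lifting respects products and stability, because every element of `H` is an element of `SH` times a
rescaling of the first row. It respects primeness, because a homogeneous ideal that is prime for
homogeneous elements is prime. `bijOn_imageIdeal` draws both bijections from these properties.

Centrality of `D_q` is the computational part. The corner generator in the first row and last column
commutes with `D_q` by counting powers of `q`. Skew derivations moving one column or one row to its
neighbour annihilate `D_q`, and carry commutation from the corner to every generator. They are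
encoded as homomorphisms into upper triangular 2 × 2 matrices. -/

noncomputable section

namespace QuantumMatrix

/-! ### Length and inversions -/

/-- The set of inversions of a permutation. -/
def inversions {n : ℕ} (σ : Equiv.Perm (Fin n)) : Finset (Fin n × Fin n) :=
  {p | p.1 < p.2 ∧ σ p.2 < σ p.1}

theorem mem_inversions {n : ℕ} {σ : Equiv.Perm (Fin n)} {p : Fin n × Fin n} :
    p ∈ inversions σ ↔ p.1 < p.2 ∧ σ p.2 < σ p.1 := by
  simp [inversions]

/-- No value lies between `a` and `a + 1`, so exchanging them alters no comparison except the one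
between these two. -/
theorem swap_lt_swap_iff {n : ℕ} {a b c d : Fin n} (hab : (b : ℕ) = a + 1)
    (h : ¬(c = a ∧ d = b)) (h' : ¬(c = b ∧ d = a)) :
    Equiv.swap a b c < Equiv.swap a b d ↔ c < d := by
  simp only [Equiv.swap_apply_def]
  split_ifs <;> simp only [Fin.lt_def, Fin.ext_iff] at * <;> omega

theorem inversions_swap_mul {n : ℕ} {a b : Fin n} (hab : (b : ℕ) = a + 1)
    {σ : Equiv.Perm (Fin n)} (h : σ⁻¹ a < σ⁻¹ b) :
    inversions (Equiv.swap a b * σ) = insert (σ⁻¹ a, σ⁻¹ b) (inversions σ) := by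
  have hlt : a < b := by rw [Fin.lt_def]; omega
  ext ⟨i, j⟩
  simp only [mem_inversions, Finset.mem_insert, Prod.mk.injEq, Equiv.Perm.mul_apply, Equiv.Perm.eq_inv_iff_eq]
  by_cases h1 : σ i = a ∧ σ j = b
  · obtain ⟨rfl, rfl⟩ := h1
    rw [Equiv.Perm.coe_inv, Equiv.symm_apply_apply, Equiv.symm_apply_apply] at h
    simp [h, hlt]
  · by_cases h2 : σ i = b ∧ σ j = a
    · obtain ⟨rfl, rfl⟩ := h2
      simp only [Equiv.Perm.coe_inv, Equiv.symm_apply_apply] at h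
      have : ¬ i < j := h.not_gt
      simp [this, hlt.ne']
    · rw [swap_lt_swap_iff hab (fun h3 => h2 h3.symm) (fun h3 => h1 h3.symm)]
      simp [h1]

theorem card_inversions_swap_mul {n : ℕ} {a b : Fin n} (hab : (b : ℕ) = a + 1)
    {σ : Equiv.Perm (Fin n)} (h : σ⁻¹ a < σ⁻¹ b) :
    (inversions (Equiv.swap a b * σ)).card = (inversions σ).card + 1 := by
  have hlt : a < b := by rw [Fin.lt_def]; omega
  rw [inversions_swap_mul hab h, Finset.card_insert_of_notMem]
  simp [mem_inversions, hlt.not_gt]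

theorem card_inversions_swap_mul_le {n : ℕ} {a b : Fin n} (hab : (b : ℕ) = a + 1)
    (σ : Equiv.Perm (Fin n)) :
    (inversions (Equiv.swap a b * σ)).card ≤ (inversions σ).card + 1 := by
  have hne : a ≠ b := by rw [Ne, Fin.ext_iff]; omega
  rcases lt_or_gt_of_ne (fun h => hne (σ⁻¹.injective h)) with h | h
  · exact (card_inversions_swap_mul hab h).le
  · have := card_inversions_swap_mul hab (σ := Equiv.swap a b * σ) (by simpa using h)
    rw [Equiv.swap_mul_self_mul] at this
    omega

theorem inversions_one (n : ℕ) : inversions (1 : Equiv.Perm (Fin n)) = ∅ := by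
  ext ⟨i, j⟩
  simpa [mem_inversions] using le_of_lt

theorem card_inversions_list_prod_le {n : ℕ} (l : List (Equiv.Perm (Fin n)))
    (hl : ∀ s ∈ l, ∃ i j : Fin n, (j : ℕ) = (i : ℕ) + 1 ∧ s = Equiv.swap i j) :
    (inversions l.prod).card ≤ l.length := by
  induction l with
  | nil => simp [inversions_one]
  | cons s l ih =>
    obtain ⟨i, j, hij, rfl⟩ := hl s (by simp)
    rw [List.prod_cons, List.length_cons]
    exact (card_inversions_swap_mul_le hij _).trans
      (Nat.succ_le_succ (ih fun s hs => hl s (by simp [hs])))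

/-- Without a descent `σ⁻¹` would be strictly increasing, and the only order automorphism of `Fin n`
is the identity. -/
theorem exists_descent {n : ℕ} {σ : Equiv.Perm (Fin n)} (hσ : σ ≠ 1) :
    ∃ a b : Fin n, (b : ℕ) = a + 1 ∧ σ⁻¹ b < σ⁻¹ a := by
  by_contra! H
  apply hσ
  rw [← inv_eq_one]
  cases n with
  | zero => exact Subsingleton.elim _ _
  | succ n =>
    have hm : StrictMono (σ⁻¹ : Equiv.Perm (Fin (n + 1))) := by
      rw [Fin.strictMono_iff_lt_succ]
      intro i
      refine lt_of_le_of_ne (H i.castSucc i.succ (by simp)) fun h => ?_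
      exact (Fin.castSucc_lt_succ (i := i)).ne (σ⁻¹.injective h)
    ext i
    have := DFunLike.congr_fun (Subsingleton.elim
      (hm.orderIsoOfSurjective _ (σ⁻¹).surjective) (OrderIso.refl _)) i
    exact congrArg Fin.val this

/-- Bubble sort: removing a descent by an adjacent transposition lowers the number of inversions by
exactly one. -/
theorem exists_list_prod {n : ℕ} (m : ℕ) (σ : Equiv.Perm (Fin n)) (hm : (inversions σ).card = m) :
    ∃ l : List (Equiv.Perm (Fin n)),
      (∀ s ∈ l, ∃ i j : Fin n, (j : ℕ) = (i : ℕ) + 1 ∧ s = Equiv.swap i j) ∧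
      l.prod = σ ∧ l.length = m := by
  induction m generalizing σ with
  | zero =>
    refine ⟨[], by simp, ?_, rfl⟩
    by_contra hne
    obtain ⟨a, b, hab, h⟩ := exists_descent (σ := σ) (fun h => hne (by simp [h]))
    have hlt : a < b := by rw [Fin.lt_def]; omega
    have : (σ⁻¹ b, σ⁻¹ a) ∈ inversions σ := by simpa [mem_inversions, hlt] using h
    rw [Finset.card_eq_zero] at hm
    simp [hm] at this
  | succ m ih =>
    have hσ : σ ≠ 1 := by
      rintro rfl
      simp [inversions_one] at hm
    obtain ⟨a, b, hab, h⟩ := exists_descent hσ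
    have hc := card_inversions_swap_mul hab (σ := Equiv.swap a b * σ) (by simpa using h)
    rw [Equiv.swap_mul_self_mul] at hc
    obtain ⟨l, hl, hp, hlen⟩ := ih (Equiv.swap a b * σ) (by omega)
    refine ⟨Equiv.swap a b :: l, ?_, by simp [hp], by simp [hlen]⟩
    intro s hs
    rcases List.mem_cons.1 hs with rfl | hs
    · exact ⟨a, b, hab, rfl⟩
    · exact hl s hs

/-- Sorting gives one bound; the other holds because an adjacent transposition adds at most one
inversion. The count of inversions shows how the sign `(-q) ^ permLength σ` changes under such a
transposition. -/
theorem permLength_eq_card_inversions {n : ℕ} (σ : Equiv.Perm (Fin n)) :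
    permLength σ = (inversions σ).card := by
  apply le_antisymm
  · exact Nat.sInf_le (exists_list_prod _ σ rfl)
  · refine le_csInf ⟨_, exists_list_prod _ σ rfl⟩ ?_
    rintro m ⟨l, hl, rfl, rfl⟩
    exact card_inversions_list_prod_le l hl

theorem permLength_swap_mul {n : ℕ} {a b : Fin n} (hab : (b : ℕ) = a + 1)
    {σ : Equiv.Perm (Fin n)} (h : σ⁻¹ a < σ⁻¹ b) :
    permLength (Equiv.swap a b * σ) = permLength σ + 1 := by
  rw [permLength_eq_card_inversions, permLength_eq_card_inversions,
    card_inversions_swap_mul hab h]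

theorem permLength_inv {n : ℕ} (σ : Equiv.Perm (Fin n)) : permLength σ⁻¹ = permLength σ := by
  rw [permLength_eq_card_inversions, permLength_eq_card_inversions]
  refine Finset.card_bij (fun p _ => (σ⁻¹ p.2, σ⁻¹ p.1)) ?_ ?_ ?_
  · rintro ⟨i, j⟩ h
    simpa [mem_inversions, and_comm] using h
  · rintro ⟨i, j⟩ _ ⟨i', j'⟩ _ h
    simpa [and_comm] using h
  · rintro ⟨i, j⟩ h
    exact ⟨(σ j, σ i), by simpa [mem_inversions, and_comm] using h, by simp⟩

theorem permLength_mul_swap {n : ℕ} {a b : Fin n} (hab : (b : ℕ) = a + 1)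
    {σ : Equiv.Perm (Fin n)} (h : σ a < σ b) :
    permLength (σ * Equiv.swap a b) = permLength σ + 1 := by
  rw [← permLength_inv, mul_inv_rev, Equiv.swap_inv, permLength_swap_mul hab (by simpa using h),
    permLength_inv]

/-! ### Homomorphisms out of `O_q(M_n(k))` -/

/-- A matrix satisfying the defining relations of `O_q(M_n(k))`. -/
structure IsQuantumMatrix {k B : Type*} [Field k] [Ring B] [Algebra k B] (q : k) {n : ℕ}
    (x : Fin n → Fin n → B) : Prop where
  col : ∀ ⦃i l : Fin n⦄ (j : Fin n), i < l → x i j * x l j = q • (x l j * x i j)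
  row : ∀ (i : Fin n) ⦃j m : Fin n⦄, j < m → x i j * x i m = q • (x i m * x i j)
  anti : ∀ ⦃i l j m : Fin n⦄, i < l → m < j → x i j * x l m = x l m * x i j
  diag : ∀ ⦃i l j m : Fin n⦄, i < l → j < m →
    x i j * x l m = x l m * x i j + (q - q⁻¹) • (x i m * x l j)

theorem isQuantumMatrix_X {k : Type*} [Field k] (q : k) (n : ℕ) : IsQuantumMatrix q (X q n) where
  col _ _ j h := X_col q n j h
  row i _ _ h := X_row q n i h
  anti _ _ _ _ h h' := X_anti q n h h'
  diag _ _ _ _ h h' := by rw [← X_diag q n h h', add_sub_cancel]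

/-- The homomorphism from `O_q(M_n(k))` given by a quantum matrix. -/
def IsQuantumMatrix.lift {k B : Type*} [Field k] [Ring B] [Algebra k B] {q : k} {n : ℕ}
    {x : Fin n → Fin n → B} (hx : IsQuantumMatrix q x) : OqM q n →ₐ[k] B :=
  RingQuot.liftAlgHom k ⟨FreeAlgebra.lift k fun p => x p.1 p.2, by
    intro y z hyz
    induction hyz with
    | col i l j h => simpa using hx.col j h
    | row i j m h => simpa using hx.row i h
    | anti i l j m h h' => simpa using hx.anti h h'
    | diag i l j m h h' =>
      simpa only [map_mul, map_sub, map_smul, FreeAlgebra.lift_ι_apply, sub_eq_iff_eq_add']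
        using hx.diag h h'⟩

theorem IsQuantumMatrix.lift_X {k B : Type*} [Field k] [Ring B] [Algebra k B] {q : k} {n : ℕ}
    {x : Fin n → Fin n → B} (hx : IsQuantumMatrix q x) (i j : Fin n) :
    hx.lift (X q n i j) = x i j :=
  (RingQuot.liftAlgHom_mkAlgHom_apply k _ _ _).trans (FreeAlgebra.lift_ι_apply _ _)

theorem IsQuantumMatrix.lift_qdet {k B : Type*} [Field k] [Ring B] [Algebra k B] {q : k} {n : ℕ}
    {x : Fin n → Fin n → B} (hx : IsQuantumMatrix q x) :
    hx.lift (qdet q n) = ∑ σ : Equiv.Perm (Fin n),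
      (-q) ^ permLength σ • (List.ofFn fun i : Fin n => x i (σ i)).prod := by
  simp only [qdet, map_sum, map_smul, map_list_prod, List.map_ofFn]
  refine Finset.sum_congr rfl fun σ _ => ?_
  congr 3
  funext i
  exact hx.lift_X i (σ i)

/-! ### Products of lists -/

/-- Positions `a` and `b` are consecutive, so the two factors stand side by side and a relation for
their product can be applied inside the ordered product. -/
theorem ofFn_prod_eq_smul {k A : Type*} [Field k] [Ring A] [Algebra k A] {n : ℕ} {a b : Fin n}
    (hab : (b : ℕ) = a + 1) {x y : Fin n → A} {c : k} (h : ∀ i, i ≠ a → i ≠ b → x i = y i)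
    (hc : x a * x b = c • (y a * y b)) :
    (List.ofFn x).prod = c • (List.ofFn y).prod := by
  induction n with
  | zero => exact a.elim0
  | succ n ih =>
    rcases Fin.eq_zero_or_eq_succ a with rfl | ⟨a, rfl⟩
    · cases n with
      | zero => have := b.2; simp at hab
      | succ n =>
        obtain rfl : b = Fin.succ 0 := by ext; simpa using hab
        have ht : (fun i : Fin n => x i.succ.succ) = fun i => y i.succ.succ := by
          funext i
          exact h _ (Fin.succ_ne_zero _) (fun h => Fin.succ_ne_zero _ (Fin.succ_injective _ h))
        simp only [List.ofFn_succ, List.prod_cons, ht, ← mul_assoc, hc, smul_mul_assoc]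
    · rcases Fin.eq_zero_or_eq_succ b with rfl | ⟨b, rfl⟩
      · simp at hab
      · rw [List.ofFn_succ, List.ofFn_succ, List.prod_cons, List.prod_cons,
          ih (a := a) (b := b) (y := fun i => y i.succ) (by simpa using hab)
            (fun i h1 h2 => h _ (by simpa using h1) (by simpa using h2)) hc,
          h 0 (Fin.succ_ne_zero _).symm (Fin.succ_ne_zero _).symm, mul_smul_comm]

theorem ofFn_prod_triangular {A : Type*} [Ring A] {n : ℕ} {M : Fin n → Matrix (Fin 2) (Fin 2) A}
    (h10 : ∀ i, M i 1 0 = 0) :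
    (List.ofFn M).prod 1 0 = 0 ∧ (List.ofFn M).prod 0 0 = (List.ofFn fun i => M i 0 0).prod ∧
      (List.ofFn M).prod 1 1 = (List.ofFn fun i => M i 1 1).prod := by
  induction n with
  | zero => simp
  | succ n ih =>
    obtain ⟨h1, h2, h3⟩ := ih fun i => h10 i.succ
    simp only [List.ofFn_succ, List.prod_cons, Matrix.mul_apply, Fin.sum_univ_two, h10, h1, h2, h3]
    simp

theorem ofFn_prod_diagonal {A : Type*} [Ring A] {n : ℕ} {M : Fin n → Matrix (Fin 2) (Fin 2) A}
    (h01 : ∀ i, M i 0 1 = 0) : (List.ofFn M).prod 0 1 = 0 := by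
  induction n with
  | zero => simp
  | succ n ih =>
    simp only [List.ofFn_succ, List.prod_cons, Matrix.mul_apply, Fin.sum_univ_two, h01,
      ih fun i => h01 i.succ]
    simp

/-- The `(0, 1)` entry sums over the place where a path steps from index 0 to index 1; only place
`r` is available. This is a Leibniz rule with one surviving term. -/
theorem ofFn_prod_corner {A : Type*} [Ring A] {n : ℕ} {M : Fin n → Matrix (Fin 2) (Fin 2) A}
    (h10 : ∀ i, M i 1 0 = 0) (r : Fin n) (h01 : ∀ i, i ≠ r → M i 0 1 = 0) :
    (List.ofFn M).prod 0 1
      = (List.ofFn fun i => if i < r then M i 0 0 else if i = r then M i 0 1 else M i 1 1).prod := by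
  induction n with
  | zero => exact r.elim0
  | succ n ih =>
    simp only [List.ofFn_succ, List.prod_cons, Matrix.mul_apply, Fin.sum_univ_two]
    rcases Fin.eq_zero_or_eq_succ r with rfl | ⟨r, rfl⟩
    · rw [ofFn_prod_diagonal fun i => h01 _ (Fin.succ_ne_zero i),
        (ofFn_prod_triangular fun i => h10 i.succ).2.2]
      simp
    · rw [ih (fun i => h10 i.succ) r fun i hi => h01 _ (by simpa using hi),
        h01 0 (Fin.succ_ne_zero r).symm]
      simp

/-! ### The column and row operators -/

theorem ext_two {A : Type*} {M N : Matrix (Fin 2) (Fin 2) A}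
    (h00 : M 0 0 = N 0 0) (h01 : M 0 1 = N 0 1) (h10 : M 1 0 = N 1 0) (h11 : M 1 1 = N 1 1) :
    M = N := by
  ext i j
  fin_cases i <;> fin_cases j <;> assumption

/-- The upper triangular matrices with diagonal entries `u_{ij} X_{ij}`, `w_{ij} X_{ij}`, and with
`e_{ij}` above the diagonal. -/
def triangularMatrix {k A : Type*} [Field k] [Ring A] [Algebra k A] {n : ℕ}
    (x : Fin n → Fin n → A) (u w : Fin n → Fin n → k) (e : Fin n → Fin n → A) (i j : Fin n) :
    Matrix (Fin 2) (Fin 2) A :=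
  !![u i j • x i j, e i j; 0, w i j • x i j]

/-- Vanishing of the 2 × 2 minors of `u` gives every monomial of a relation the same scalar factor.
-/
theorem IsQuantumMatrix.smul {k A : Type*} [Field k] [Ring A] [Algebra k A] {q : k} {n : ℕ}
    {x : Fin n → Fin n → A} (hx : IsQuantumMatrix q x) {u : Fin n → Fin n → k}
    (hu : ∀ i j l m, u i j * u l m = u i m * u l j) :
    IsQuantumMatrix q fun i j => u i j • x i j where
  col _ _ j h := by
    rw [smul_mul_smul_comm, smul_mul_smul_comm, hx.col j h, smul_comm q, mul_comm]
  row i _ _ h := by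
    rw [smul_mul_smul_comm, smul_mul_smul_comm, hx.row i h, smul_comm q, mul_comm]
  anti _ _ _ _ h h' := by
    rw [smul_mul_smul_comm, smul_mul_smul_comm, hx.anti h h', mul_comm]
  diag i l j m h h' := by
    simp only [smul_mul_smul_comm]
    rw [hx.diag h h', ← hu i j l m, smul_add, smul_comm (q - q⁻¹), mul_comm]

/-- The diagonal entries satisfy the relations as rescalings of `x`, so only the `(0, 1)` entries,
which are the four last hypotheses, remain to be checked. -/
theorem isQuantumMatrix_triangularMatrix {k A : Type*} [Field k] [Ring A] [Algebra k A] {q : k}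
    {n : ℕ} {x : Fin n → Fin n → A} (hx : IsQuantumMatrix q x) {u w : Fin n → Fin n → k}
    (hu : ∀ i j l m, u i j * u l m = u i m * u l j)
    (hw : ∀ i j l m, w i j * w l m = w i m * w l j)
    {e : Fin n → Fin n → A}
    (col : ∀ ⦃i l : Fin n⦄ (j : Fin n), i < l →
      u i j • (x i j * e l j) + w l j • (e i j * x l j)
        = q • (u l j • (x l j * e i j) + w i j • (e l j * x i j)))
    (row : ∀ (i : Fin n) ⦃j m : Fin n⦄, j < m →
      u i j • (x i j * e i m) + w i m • (e i j * x i m)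
        = q • (u i m • (x i m * e i j) + w i j • (e i m * x i j)))
    (anti : ∀ ⦃i l j m : Fin n⦄, i < l → m < j →
      u i j • (x i j * e l m) + w l m • (e i j * x l m)
        = u l m • (x l m * e i j) + w i j • (e l m * x i j))
    (diag : ∀ ⦃i l j m : Fin n⦄, i < l → j < m →
      u i j • (x i j * e l m) + w l m • (e i j * x l m)
        = u l m • (x l m * e i j) + w i j • (e l m * x i j)
          + (q - q⁻¹) • (u i m • (x i m * e l j) + w l j • (e i m * x l j))) :
    IsQuantumMatrix q (triangularMatrix x u w e) := by
  constructor
  · intro i l j h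
    apply ext_two
    · simpa [triangularMatrix, -Algebra.mul_smul_comm] using (hx.smul hu).col j h
    · simpa [triangularMatrix] using col j h
    · simp [triangularMatrix]
    · simpa [triangularMatrix, -Algebra.mul_smul_comm] using (hx.smul hw).col j h
  · intro i j m h
    apply ext_two
    · simpa [triangularMatrix, -Algebra.mul_smul_comm] using (hx.smul hu).row i h
    · simpa [triangularMatrix] using row i h
    · simp [triangularMatrix]
    · simpa [triangularMatrix, -Algebra.mul_smul_comm] using (hx.smul hw).row i h
  · intro i l j m h h'
    apply ext_two
    · simpa [triangularMatrix, -Algebra.mul_smul_comm] using (hx.smul hu).anti h h'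
    · simpa [triangularMatrix] using anti h h'
    · simp [triangularMatrix]
    · simpa [triangularMatrix, -Algebra.mul_smul_comm] using (hx.smul hw).anti h h'
  · intro i l j m h h'
    apply ext_two
    · simpa [triangularMatrix, -Algebra.mul_smul_comm] using (hx.smul hu).diag h h'
    · simpa [triangularMatrix] using diag h h'
    · simp [triangularMatrix]
    · simpa [triangularMatrix, -Algebra.mul_smul_comm] using (hx.smul hw).diag h h'

/-- The matrix of the column operator taking `X_{ib}` to `X_{ia}`. -/
def colMatrix {k : Type*} [Field k] (q : k) {n : ℕ} (a b : Fin n) :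
    Fin n → Fin n → Matrix (Fin 2) (Fin 2) (OqM q n) :=
  triangularMatrix (X q n) (fun _ j => if j = a then q else 1) (fun _ j => if j = b then q else 1)
    fun i j => if j = b then X q n i a else 0

/-- The matrix of the row operator taking `X_{aj}` to `X_{bj}`. -/
def rowMatrix {k : Type*} [Field k] (q : k) {n : ℕ} (a b : Fin n) :
    Fin n → Fin n → Matrix (Fin 2) (Fin 2) (OqM q n) :=
  triangularMatrix (X q n) (fun i _ => if i = a then q else 1) (fun i _ => if i = b then q else 1)
    fun i j => if i = a then X q n b j else 0

/-- The `(0, 1)` entry of the resulting homomorphism is a skew derivation, like the action of a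
Chevalley generator of the quantum group. Since `a` and `b` are adjacent, replacing column `b` by
`a` changes the type of a relation only when both columns are involved, and the weights `q`
compensate for it. -/
theorem isQuantumMatrix_colMatrix {k : Type*} [Field k] {q : k} (hq0 : q ≠ 0) {n : ℕ}
    {a b : Fin n} (hab : (b : ℕ) = a + 1) : IsQuantumMatrix q (colMatrix q a b) := by
  have hlt : a < b := by rw [Fin.lt_def]; omega
  have hX := isQuantumMatrix_X q n
  have key : ∀ j, j < b → j = a ∨ j < a := fun j hj => by
    rw [Fin.lt_def] at *; rw [Fin.ext_iff]; omega
  refine isQuantumMatrix_triangularMatrix hX (fun _ _ _ _ => mul_comm _ _)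
    (fun _ _ _ _ => mul_comm _ _) ?_ ?_ ?_ ?_
  · intro i l j h
    by_cases hj : j = b
    · subst hj
      simp [hlt.ne', hX.anti h hlt, hX.diag h hlt]
      match_scalars
      all_goals field_simp
      all_goals ring
    · simp [hj]
  · intro i j m h
    by_cases hm : m = b
    · subst hm
      rcases key j h with rfl | hj
      · simp [h.ne]
      · simp [h.ne, hj.ne, hX.row i hj]
    · by_cases hj : j = b
      · subst hj
        have ha : m ≠ a := (hlt.trans h).ne'
        simp [hm, ha, hX.row i (hlt.trans h)]
      · simp [hm, hj]
  · intro i l j m h h'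
    by_cases hm : m = b
    · subst hm
      simp [h'.ne', (hlt.trans h').ne', hX.anti h (hlt.trans h')]
    · by_cases hj : j = b
      · subst hj
        rcases key m h' with rfl | hma
        · simp [h'.ne, hX.col m h]
        · simp [h'.ne, hma.ne, hX.anti h hma]
      · simp [hm, hj]
  · intro i l j m h h'
    by_cases hm : m = b
    · subst hm
      rcases key j h' with rfl | hj
      · simp [h'.ne, hX.col j h]
        match_scalars; field_simp; ring
      · simp [h'.ne, hj.ne, hX.diag h hj]
    · by_cases hj : j = b
      · subst hj
        have ha : m ≠ a := (hlt.trans h').ne'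
        simp [hm, ha, hX.diag h (hlt.trans h')]
      · simp [hm, hj]

theorem isQuantumMatrix_rowMatrix {k : Type*} [Field k] {q : k} (hq0 : q ≠ 0) {n : ℕ}
    {a b : Fin n} (hab : (b : ℕ) = a + 1) : IsQuantumMatrix q (rowMatrix q a b) := by
  have hlt : a < b := by rw [Fin.lt_def]; omega
  have hX := isQuantumMatrix_X q n
  have key : ∀ j, a < j → j = b ∨ b < j := fun j hj => by
    rw [Fin.lt_def] at *; rw [Fin.ext_iff]; omega
  refine isQuantumMatrix_triangularMatrix hX (fun _ _ _ _ => rfl)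
    (fun _ _ _ _ => rfl) ?_ ?_ ?_ ?_
  · intro i l j h
    by_cases hi : i = a
    · subst hi
      rcases key l h with rfl | hl
      · simp [h.ne']
      · simp [h.ne', hl.ne', hX.col j hl]
    · by_cases hl : l = a
      · subst hl
        have hb : i ≠ b := (h.trans hlt).ne
        simp [hi, hb, hX.col j (h.trans hlt)]
      · simp [hi, hl]
  · intro i j m h
    by_cases hi : i = a
    · subst hi
      simp [hlt.ne, hX.anti hlt h, hX.diag hlt h]
      match_scalars
      all_goals field_simp
      all_goals ring
    · simp [hi]
  · intro i l j m h h'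
    by_cases hi : i = a
    · subst hi
      rcases key l h with rfl | hl
      · simp [h.ne', h.ne, hX.row l h']
      · simp [h.ne', hl.ne', hlt.ne, hX.anti hl h']
    · by_cases hl : l = a
      · subst hl
        have hb : i ≠ b := (h.trans hlt).ne
        simp [hi, hb, hX.anti (h.trans hlt) h']
      · simp [hi, hl]
  · intro i l j m h h'
    by_cases hi : i = a
    · subst hi
      rcases key l h with rfl | hl
      · simp [h.ne', h.ne, hX.row l h']
        match_scalars; field_simp; ring
      · simp [h.ne', hl.ne', hlt.ne, hX.diag hl h']
    · by_cases hl : l = a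
      · subst hl
        have hb : i ≠ b := (h.trans hlt).ne
        simp [hi, hb, hX.diag (h.trans hlt) h']
      · simp [hi, hl]

/-! ### The quantum determinant is central -/

theorem lift_triangularMatrix_qdet {k : Type*} [Field k] {q : k} {n : ℕ}
    {u w : Fin n → Fin n → k} {e : Fin n → Fin n → OqM q n}
    (h : IsQuantumMatrix q (triangularMatrix (X q n) u w e)) {c d : k}
    (hu : ∀ σ : Equiv.Perm (Fin n), ∏ i, u i (σ i) = c)
    (hw : ∀ σ : Equiv.Perm (Fin n), ∏ i, w i (σ i) = d)
    (he : ∑ σ : Equiv.Perm (Fin n), (-q) ^ permLength σ •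
      (List.ofFn fun i : Fin n => triangularMatrix (X q n) u w e i (σ i)).prod 0 1 = 0) :
    h.lift (qdet q n) = !![c • qdet q n, 0; 0, d • qdet q n] := by
  have ht := fun σ : Equiv.Perm (Fin n) => ofFn_prod_triangular
    (M := fun i : Fin n => triangularMatrix (X q n) u w e i (σ i)) fun i => by
      simp [triangularMatrix]
  rw [h.lift_qdet]
  apply ext_two
  · simp only [Matrix.sum_apply, Matrix.smul_apply, (ht _).2.1]
    simp [triangularMatrix, ofFn_smul_prod, hu, qdet, Finset.smul_sum, smul_comm c]
  · simp only [Matrix.sum_apply, Matrix.smul_apply]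
    exact he
  · simp only [Matrix.sum_apply, Matrix.smul_apply, (ht _).1]
    simp
  · simp only [Matrix.sum_apply, Matrix.smul_apply, (ht _).2.2]
    simp [triangularMatrix, ofFn_smul_prod, hw, qdet, Finset.smul_sum, smul_comm d]

/-- Compare the `(0, 1)` entries of `f D * f x = f x * f D` and cancel `c`. -/
theorem commute_of_map_diagonal {k A : Type*} [Field k] [Ring A] [Algebra k A] {c : k} (hc : c ≠ 0)
    {D x : A} (f : A →ₐ[k] Matrix (Fin 2) (Fin 2) A) (hD : f D = !![c • D, 0; 0, c • D])
    (hx : Commute D x) : Commute D (f x 0 1) := by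
  have h := congrArg f hx.eq
  rw [map_mul, map_mul, hD] at h
  have h01 := congrFun (congrFun h 0) 1
  simp only [Matrix.mul_apply, Fin.sum_univ_two] at h01
  rw [commute_iff_eq]
  simpa [hc] using h01

/-- The corner entry vanishes by pairing `σ` with `swap a b * σ`: once column `b` is replaced by
`a`, both give the same monomial, and the coefficients cancel as `(-q) ^ ℓ * q + (-q) ^ (ℓ + 1) =
0`. -/
theorem lift_colMatrix_qdet {k : Type*} [Field k] {q : k} (hq0 : q ≠ 0) {n : ℕ} {a b : Fin n}
    (hab : (b : ℕ) = a + 1) :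
    (isQuantumMatrix_colMatrix hq0 hab).lift (qdet q n)
      = !![q • qdet q n, 0; 0, q • qdet q n] := by
  have hlt : a < b := by rw [Fin.lt_def]; omega
  apply lift_triangularMatrix_qdet
  · intro σ
    simp [Equiv.prod_comp σ fun j => if j = a then q else 1]
  · intro σ
    simp [Equiv.prod_comp σ fun j => if j = b then q else 1]
  have hterm : ∀ σ : Equiv.Perm (Fin n),
      (List.ofFn fun i : Fin n => colMatrix q a b i (σ i)).prod 0 1
        = (if σ⁻¹ a < σ⁻¹ b then q else 1) •
          (List.ofFn fun i : Fin n => X q n i (if σ i = b then a else σ i)).prod := by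
    intro σ
    rw [ofFn_prod_corner (fun i => by simp [colMatrix, triangularMatrix]) (σ⁻¹ b) (fun i hi => by
      have : σ i ≠ b := fun h => hi (by simp [← h])
      simp [colMatrix, triangularMatrix, this])]
    -- Before the corner, at row `σ⁻¹ b`, the weight is `q` in column `a`; after it, `q` in column
    -- `b`, which no longer occurs.
    have hprod : (if σ⁻¹ a < σ⁻¹ b then q else 1)
        = ∏ i, if i < σ⁻¹ b ∧ i = σ⁻¹ a then q else 1 := by
      rw [Finset.prod_eq_single (σ⁻¹ a) (by simp +contextual) (by simp)]
      simp
    rw [hprod, ← ofFn_smul_prod]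
    congr 2
    funext i
    have hia : i = σ⁻¹ a ↔ σ i = a := Equiv.Perm.eq_inv_iff_eq
    have hib : i = σ⁻¹ b ↔ σ i = b := Equiv.Perm.eq_inv_iff_eq
    rcases lt_trichotomy i (σ⁻¹ b) with h | h | h
    · have h1 : σ i ≠ b := fun h1 => h.ne (hib.2 h1)
      simp only [h, if_true, hia, h1, if_false, true_and]
      simp [colMatrix, triangularMatrix]
    · have h1 : σ i = b := hib.1 h
      simp [← h, h1, colMatrix, triangularMatrix]
    · have h1 : σ i ≠ b := fun h1 => h.ne' (hib.2 h1)
      simp only [h.not_gt, h.ne', if_false, false_and, h1]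
      simp [colMatrix, triangularMatrix, h1]
  have key : ∀ σ : Equiv.Perm (Fin n), σ⁻¹ a < σ⁻¹ b →
      (-q) ^ permLength σ • (List.ofFn fun i : Fin n => colMatrix q a b i (σ i)).prod 0 1 +
      (-q) ^ permLength (Equiv.swap a b * σ) •
        (List.ofFn fun i : Fin n => colMatrix q a b i ((Equiv.swap a b * σ) i)).prod 0 1 = 0 := by
    intro σ h
    have hfun : (fun i : Fin n => X q n i
        (if (Equiv.swap a b * σ) i = b then a else (Equiv.swap a b * σ) i))
        = fun i => X q n i (if σ i = b then a else σ i) := by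
      funext i
      congr 1
      simp only [Equiv.Perm.mul_apply, Equiv.swap_apply_def]
      split_ifs <;> simp_all
    have h' : ¬ (Equiv.swap a b * σ)⁻¹ a < (Equiv.swap a b * σ)⁻¹ b := by
      simpa using h.le
    rw [hterm, hterm, hfun, permLength_swap_mul hab h, if_pos h, if_neg h', smul_smul, smul_smul,
      ← add_smul, pow_succ]
    simp
  refine Finset.sum_involution (fun σ _ => Equiv.swap a b * σ) ?_ ?_ ?_ ?_
  · intro σ _
    rcases lt_or_gt_of_ne (fun h => hlt.ne (σ⁻¹.injective h)) with h | h
    · exact key σ h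
    · have := key (Equiv.swap a b * σ) (by simpa using h)
      rwa [Equiv.swap_mul_self_mul, add_comm] at this
  · intro σ _ _ h
    exact hlt.ne (Equiv.swap_eq_one_iff.1 (mul_eq_right.1 h))
  · simp
  · simp [Equiv.swap_mul_self_mul]

/-- Here `σ` is paired with `σ * swap a b`. Replacing row `a` by `b` leaves two consecutive factors
from row `b`; exchanging them by the row relation costs the `q` that cancels the change of sign and
length. -/
theorem lift_rowMatrix_qdet {k : Type*} [Field k] {q : k} (hq0 : q ≠ 0) {n : ℕ} {a b : Fin n}
    (hab : (b : ℕ) = a + 1) :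
    (isQuantumMatrix_rowMatrix hq0 hab).lift (qdet q n)
      = !![q • qdet q n, 0; 0, q • qdet q n] := by
  have hlt : a < b := by rw [Fin.lt_def]; omega
  apply lift_triangularMatrix_qdet
  · simp
  · simp
  have hterm : ∀ σ : Equiv.Perm (Fin n),
      (List.ofFn fun i : Fin n => rowMatrix q a b i (σ i)).prod 0 1
        = q • (List.ofFn fun i : Fin n => X q n (if i = a then b else i) (σ i)).prod := by
    intro σ
    rw [ofFn_prod_corner (fun i => by simp [rowMatrix, triangularMatrix]) a (fun i hi => by
      simp [rowMatrix, triangularMatrix, hi])]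
    have hprod : ∏ i, (if i = b then q else 1) = q := by simp
    refine Eq.trans ?_ (congrArg (· • _) hprod)
    rw [← ofFn_smul_prod]
    congr 2
    funext i
    rcases lt_trichotomy i a with h | h | h
    · simp [h, h.ne, (h.trans hlt).ne, rowMatrix, triangularMatrix]
    · simp [h, hlt.ne, rowMatrix, triangularMatrix]
    · simp [h.not_gt, h.ne', rowMatrix, triangularMatrix]
  have key : ∀ σ : Equiv.Perm (Fin n), σ a < σ b →
      (-q) ^ permLength σ • (List.ofFn fun i : Fin n => rowMatrix q a b i (σ i)).prod 0 1 +
      (-q) ^ permLength (σ * Equiv.swap a b) •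
        (List.ofFn fun i : Fin n => rowMatrix q a b i ((σ * Equiv.swap a b) i)).prod 0 1 = 0 := by
    intro σ h
    rw [hterm, hterm, permLength_mul_swap hab h, ofFn_prod_eq_smul hab (c := q)
      (y := fun i : Fin n => X q n (if i = a then b else i) ((σ * Equiv.swap a b) i))]
    · rw [smul_smul, smul_smul, smul_smul, ← add_smul, pow_succ]
      ring_nf
      simp
    · intro i ha hb
      simp [ha, Equiv.swap_apply_of_ne_of_ne ha hb]
    · simpa [hlt.ne'] using X_row q n b h
  refine Finset.sum_involution (fun σ _ => σ * Equiv.swap a b) ?_ ?_ ?_ ?_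
  · intro σ _
    rcases lt_or_gt_of_ne (fun h => hlt.ne (σ.injective h)) with h | h
    · exact key σ h
    · have := key (σ * Equiv.swap a b) (by simpa using h)
      rwa [Equiv.mul_swap_mul_self, add_comm] at this
  · intro σ _ _ h
    exact hlt.ne (Equiv.swap_eq_one_iff.1 (mul_eq_left.1 h))
  · simp
  · simp [Equiv.mul_swap_mul_self]

theorem ofFn_prod_mul_of_skew {k A : Type*} [Field k] [Ring A] [Algebra k A] {n : ℕ} {y : A}
    {x : Fin n → A} {c : Fin n → k} (h : ∀ i, y * x i = c i • (x i * y)) :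
    y * (List.ofFn x).prod = (∏ i, c i) • ((List.ofFn x).prod * y) := by
  induction n with
  | zero => simp
  | succ n ih =>
    rw [List.ofFn_succ, List.prod_cons, ← mul_assoc, h 0, smul_mul_assoc, mul_assoc,
      ih fun i => h i.succ, Fin.prod_univ_succ, mul_smul_comm, smul_smul, mul_assoc]

/-- A corner generator never meets the relation `X_diag`, so it commutes with each generator up to a
scalar. Each monomial of `D_q` contributes one `q⁻¹` from row `0` and one `q` from the last column.
-/
theorem commute_qdet_corner {k : Type*} [Field k] {q : k} (hq0 : q ≠ 0) (n : ℕ) :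
    Commute (qdet q (n + 1)) (X q (n + 1) 0 (Fin.last n)) := by
  have hskew : ∀ i j : Fin (n + 1), X q (n + 1) 0 (Fin.last n) * X q (n + 1) i j
      = ((if i = 0 then q⁻¹ else 1) * (if j = Fin.last n then q else 1)) •
        (X q (n + 1) i j * X q (n + 1) 0 (Fin.last n)) := by
    intro i j
    rcases eq_or_ne i 0 with rfl | hi <;> rcases eq_or_ne j (Fin.last n) with rfl | hj
    · simp [hq0]
    · rw [X_row q _ 0 (Fin.lt_last_iff_ne_last.2 hj)]
      simp [hj, smul_smul, hq0]
    · rw [X_col q _ _ (Fin.pos_iff_ne_zero.2 hi)]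
      simp [hi]
    · rw [X_anti q _ (Fin.pos_iff_ne_zero.2 hi) (Fin.lt_last_iff_ne_last.2 hj)]
      simp [hi, hj]
  refine Commute.sum_left _ _ _ fun σ _ => Commute.smul_left (Eq.symm ?_) _
  rw [ofFn_prod_mul_of_skew fun i => hskew i (σ i), Finset.prod_mul_distrib,
    Equiv.prod_comp σ fun j => if j = Fin.last n then q else 1]
  simp [hq0]

theorem commute_qdet_X {k : Type*} [Field k] {q : k} (hq0 : q ≠ 0) {n : ℕ} (i j : Fin n) :
    Commute (qdet q n) (X q n i j) := by
  cases n with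
  | zero => exact i.elim0
  | succ n =>
    have hcol : ∀ j, Commute (qdet q (n + 1)) (X q (n + 1) 0 j) := by
      intro j
      induction j using Fin.reverseInduction with
      | last => exact commute_qdet_corner hq0 n
      | cast j ih =>
        have hab : ((j.succ : Fin (n + 1)) : ℕ) = (j.castSucc : Fin (n + 1)) + 1 := by simp
        have := commute_of_map_diagonal hq0 _ (lift_colMatrix_qdet hq0 hab) ih
        simpa [IsQuantumMatrix.lift_X, colMatrix, triangularMatrix] using this
    induction i using Fin.induction with
    | zero => exact hcol j
    | succ i ih =>
      have hab : ((i.succ : Fin (n + 1)) : ℕ) = (i.castSucc : Fin (n + 1)) + 1 := by simp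
      have := commute_of_map_diagonal hq0 _ (lift_rowMatrix_qdet hq0 hab) ih
      simpa [IsQuantumMatrix.lift_X, rowMatrix, triangularMatrix] using this

theorem OqM_induction {k : Type*} [Field k] {q : k} {n : ℕ} {p : OqM q n → Prop}
    (hc : ∀ c, p (algebraMap k _ c)) (hX : ∀ i j, p (X q n i j))
    (hadd : ∀ x y, p x → p y → p (x + y)) (hmul : ∀ x y, p x → p y → p (x * y)) (x : OqM q n) :
    p x := by
  obtain ⟨x, rfl⟩ := RingQuot.mkAlgHom_surjective k (Rel q n) x
  induction x using FreeAlgebra.induction with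
  | grade0 c => rw [AlgHom.commutes]; exact hc c
  | grade1 ij => exact hX ij.1 ij.2
  | mul a b ha hb => rw [map_mul]; exact hmul _ _ ha hb
  | add a b ha hb => rw [map_add]; exact hadd _ _ ha hb

theorem commute_qdet {k : Type*} [Field k] {q : k} (hq0 : q ≠ 0) {n : ℕ} (x : OqM q n) :
    Commute (qdet q n) x := by
  induction x using OqM_induction with
  | hc c => exact (Algebra.commutes c _).symm
  | hX i j => exact commute_qdet_X hq0 i j
  | hadd x y hx hy => exact hx.add_right hy
  | hmul x y hx hy => exact hx.mul_right hy

open Polynomial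

theorem mem_of_pow_mul_mem {A : Type*} [Ring A] {P : TwoSidedIdeal A} {D : A}
    (hsat : ∀ a, D * a ∈ P → a ∈ P) (i : ℕ) {a : A} (ha : D ^ i * a ∈ P) : a ∈ P := by
  induction i with
  | zero => simpa using ha
  | succ i ih => exact ih (hsat _ (by rwa [← mul_assoc, ← pow_succ']))

/-! ### Positively graded algebras with a central element of degree one -/

/-- A grading of the algebra `A` by the natural numbers, as a coaction `A → A[t]`, together with a
central element `D` of degree one. -/
structure Grading {k A : Type*} [Field k] [Ring A] [Algebra k A] (Γ : A →ₐ[k] A[X]) (D : A) :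
    Prop where
  eval : ∀ a, (Γ a).eval 1 = a
  coassoc : ∀ a m, Γ ((Γ a).coeff m) = monomial m ((Γ a).coeff m)
  central : ∀ a, Commute D a
  map_D : Γ D = monomial 1 D

/-- An ideal is homogeneous if it contains the homogeneous components of its elements. -/
def IsHomogeneousIdeal {k A : Type*} [Field k] [Ring A] [Algebra k A] (Γ : A →ₐ[k] A[X])
    (P : TwoSidedIdeal A) : Prop :=
  ∀ a ∈ P, ∀ m, (Γ a).coeff m ∈ P

/-- Multiplies each component of degree at most `N` by the power of `D` that brings it into
degree `N`. -/
def homogenize {k A : Type*} [Field k] [Ring A] [Algebra k A] (Γ : A →ₐ[k] A[X]) (D : A)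
    (N : ℕ) (a : A) : A :=
  ∑ i ∈ Finset.range (N + 1), D ^ (N - i) * (Γ a).coeff i

section

variable {k A : Type*} [Field k] [Ring A] [Algebra k A] {Γ : A →ₐ[k] A[X]} {D : A}

theorem homogenize_succ (N : ℕ) (a : A) :
    homogenize Γ D (N + 1) a = D * homogenize Γ D N a + (Γ a).coeff (N + 1) := by
  rw [homogenize, Finset.sum_range_succ, homogenize, Finset.mul_sum]
  congr 1
  · refine Finset.sum_congr rfl fun i hi => ?_
    rw [← mul_assoc, ← pow_succ', Nat.succ_sub (Nat.lt_succ_iff.1 (Finset.mem_range.1 hi))]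
  · simp

theorem homogenize_sub (N : ℕ) (a b : A) :
    homogenize Γ D N (a - b) = homogenize Γ D N a - homogenize Γ D N b := by
  simp [homogenize, mul_sub]

theorem homogenize_mem {P : TwoSidedIdeal A} (hP : IsHomogeneousIdeal Γ P) (N : ℕ) {a : A}
    (ha : a ∈ P) : homogenize Γ D N a ∈ P :=
  sum_mem fun i _ => P.mul_mem_left _ _ (hP a ha i)

theorem homogenize_of_homogeneous {m N : ℕ} (hmN : m ≤ N) {a : A} (ha : Γ a = monomial m a) :
    homogenize Γ D N a = D ^ (N - m) * a := by
  rw [homogenize, Finset.sum_eq_single m]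
  · simp [ha]
  · intro i _ hi
    simp [ha, coeff_monomial, hi.symm]
  · intro h
    exact absurd (Finset.mem_range.2 (Nat.lt_succ_of_le hmN)) h

namespace Grading

variable (h : Grading Γ D)
include h

/-- The component of `(D - 1) * c` in degree `i` is `D * c_{i-1} - c_i`, and after weighting by
powers of `D` the sum telescopes. -/
theorem homogenize_sub_one_mul (N : ℕ) (c : A) :
    homogenize Γ D N ((D - 1) * c) = -(Γ c).coeff N := by
  have hΓ : Γ ((D - 1) * c) = C D * (Polynomial.X * Γ c) - Γ c := by
    rw [sub_mul, one_mul, map_sub, map_mul, h.map_D, ← mul_assoc, C_mul_X_eq_monomial]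
  induction N with
  | zero => simp [homogenize, hΓ]
  | succ N ih =>
    rw [homogenize_succ, ih, hΓ]
    simp only [coeff_sub, coeff_C_mul, coeff_X_mul]
    noncomm_ring

theorem map_D_pow_mul (i : ℕ) {j : ℕ} {a : A} (ha : Γ a = monomial j a) :
    Γ (D ^ i * a) = monomial (i + j) (D ^ i * a) := by
  rw [map_mul, map_pow, h.map_D, ha, monomial_pow, one_mul, monomial_mul_monomial]

theorem map_homogenize (N : ℕ) (a : A) :
    Γ (homogenize Γ D N a) = monomial N (homogenize Γ D N a) := by
  rw [homogenize, map_sum, map_sum]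
  refine Finset.sum_congr rfl fun i hi => ?_
  rw [h.map_D_pow_mul _ (h.coassoc a i),
    Nat.sub_add_cancel (Nat.lt_succ_iff.1 (Finset.mem_range.1 hi))]

theorem sum_coeff {N : ℕ} {a : A} (hN : (Γ a).natDegree ≤ N) :
    ∑ i ∈ Finset.range (N + 1), (Γ a).coeff i = a := by
  conv_rhs => rw [← h.eval a, eval_eq_sum_range' (Nat.lt_succ_of_le hN)]
  simp

/-- A homogeneous ideal on which `D` acts injectively contains every homogeneous element that lies
in it modulo `D - 1`. -/
theorem mem_of_sub_mem {P : TwoSidedIdeal A} (hP : IsHomogeneousIdeal Γ P)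
    (hsat : ∀ a, D * a ∈ P → a ∈ P) {m : ℕ} {a p c : A} (ha : Γ a = monomial m a) (hp : p ∈ P)
    (hc : a - p = (D - 1) * c) : a ∈ P := by
  -- The chosen degree is at least `m` and exceeds the degree of `c`, so the right side vanishes. It
  -- may truncate `p`, harmlessly, since every component of `p` lies in `P`.
  have h1 := congrArg (homogenize Γ D (m + (Γ c).natDegree + 1)) hc
  rw [homogenize_sub, h.homogenize_sub_one_mul, homogenize_of_homogeneous (by omega) ha,
    coeff_eq_zero_of_natDegree_lt (by omega), neg_zero, sub_eq_zero] at h1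
  exact mem_of_pow_mul_mem hsat _ (h1 ▸ homogenize_mem hP _ hp)

end Grading

end

/-! ### Lifting ideals from the quotient by `D - 1` -/

/-- The ideal spanned by the homogeneous elements whose image lies in `Q`. -/
def liftIdeal {k A B : Type*} [Field k] [Ring A] [Algebra k A] [Ring B] [Algebra k B]
    (Γ : A →ₐ[k] A[X]) (π : A →ₐ[k] B) (Q : TwoSidedIdeal B) : TwoSidedIdeal A :=
  TwoSidedIdeal.mk' {a | ∀ m, π ((Γ a).coeff m) ∈ Q}
    (fun m => by simp)
    (fun ha hb m => by simpa using Q.add_mem (ha m) (hb m))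
    (fun ha m => by simpa using Q.neg_mem (ha m))
    (fun {x y} hy m => by
      rw [map_mul, coeff_mul, map_sum]
      exact sum_mem fun p _ => by rw [map_mul]; exact Q.mul_mem_left _ _ (hy _))
    (fun {x y} hx m => by
      rw [map_mul, coeff_mul, map_sum]
      exact sum_mem fun p _ => by rw [map_mul]; exact Q.mul_mem_right _ _ (hx _))

section

variable {k A B : Type*} [Field k] [Ring A] [Algebra k A] [Ring B] [Algebra k B]
  {Γ : A →ₐ[k] A[X]} {D : A} {π : A →ₐ[k] B}

theorem mem_liftIdeal {Q : TwoSidedIdeal B} {a : A} :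
    a ∈ liftIdeal Γ π Q ↔ ∀ m, π ((Γ a).coeff m) ∈ Q :=
  TwoSidedIdeal.mem_mk' _ _ _ _ _ _ a

theorem mul_mem_liftIdeal {I J Q : TwoSidedIdeal B} (hIJ : ∀ a ∈ I, ∀ b ∈ J, a * b ∈ Q) :
    ∀ a ∈ liftIdeal Γ π I, ∀ b ∈ liftIdeal Γ π J, a * b ∈ liftIdeal Γ π Q := by
  intro a ha b hb
  rw [mem_liftIdeal] at *
  intro m
  rw [map_mul, coeff_mul, map_sum]
  exact sum_mem fun p _ => by rw [map_mul]; exact hIJ _ (ha _) _ (hb _)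

theorem mem_liftIdeal_of_homogeneous {Q : TwoSidedIdeal B} {m : ℕ} {a : A}
    (ha : Γ a = monomial m a) : a ∈ liftIdeal Γ π Q ↔ π a ∈ Q := by
  rw [mem_liftIdeal, ha]
  refine ⟨fun h => by simpa using h m, fun h l => ?_⟩
  rw [coeff_monomial]
  split_ifs
  · exact h
  · simp

theorem liftIdeal_mono {Q Q' : TwoSidedIdeal B} (hQ : Q ≤ Q') :
    liftIdeal Γ π Q ≤ liftIdeal Γ π Q' := by
  intro a ha
  rw [mem_liftIdeal] at *
  exact fun m => hQ (ha m)

namespace Grading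

variable (h : Grading Γ D)
include h

theorem isHomogeneousIdeal_liftIdeal (Q : TwoSidedIdeal B) :
    IsHomogeneousIdeal Γ (liftIdeal Γ π Q) := by
  intro a ha m
  rw [mem_liftIdeal_of_homogeneous (h.coassoc a m)]
  exact mem_liftIdeal.1 ha m

theorem map_mem_of_mem_liftIdeal {Q : TwoSidedIdeal B} {a : A} (ha : a ∈ liftIdeal Γ π Q) :
    π a ∈ Q := by
  rw [← h.sum_coeff (a := a) le_rfl, map_sum]
  exact sum_mem fun i _ => mem_liftIdeal.1 ha i

/-- Powers of `D` are invisible to `π`, so homogenizing `a` up to its top degree does not change the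
image. -/
theorem exists_mem_liftIdeal (hD : π D = 1) {Q : TwoSidedIdeal B} {a : A} (ha : π a ∈ Q) :
    ∃ b ∈ liftIdeal Γ π Q, π b = π a := by
  have hπ : π (homogenize Γ D (Γ a).natDegree a) = π a := by
    conv_rhs => rw [← h.sum_coeff (a := a) le_rfl]
    simp [homogenize, hD]
  exact ⟨_, (mem_liftIdeal_of_homogeneous (h.map_homogenize _ a)).2 (hπ ▸ ha), hπ⟩

theorem mem_of_map_mem (hker : ∀ a, π a = 0 → ∃ c, a = (D - 1) * c) {P : TwoSidedIdeal A}
    (hP : IsHomogeneousIdeal Γ P) (hsat : ∀ a, D * a ∈ P → a ∈ P) {m : ℕ} {a p : A}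
    (ha : Γ a = monomial m a) (hp : p ∈ P) (hap : π p = π a) : a ∈ P := by
  obtain ⟨c, hc⟩ := hker (a - p) (by rw [map_sub, hap, sub_self])
  exact h.mem_of_sub_mem hP hsat ha hp hc

end Grading

/-- Elementwise form of primeness. -/
theorem IsPrimeIdeal.mem_or_mem {P : TwoSidedIdeal A} (hP : IsPrimeIdeal P) {x y : A}
    (hxy : ∀ c, x * c * y ∈ P) : x ∈ P ∨ y ∈ P := by
  -- Annihilators modulo `P` serve in place of the ideals generated by `x` and `y`, so no spans of
  -- products need to be described.
  let J : TwoSidedIdeal A := TwoSidedIdeal.mk' {b | ∀ c, x * c * b ∈ P}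
    (fun c => by simp)
    (fun hb hb' c => by rw [mul_add]; exact P.add_mem (hb c) (hb' c))
    (fun hb c => by rw [mul_neg]; exact P.neg_mem (hb c))
    (fun {a b} hb c => by rw [← mul_assoc, mul_assoc x]; exact hb _)
    (fun {b a} hb c => by rw [← mul_assoc]; exact P.mul_mem_right _ _ (hb c))
  have hJ : ∀ b, b ∈ J ↔ ∀ c, x * c * b ∈ P := TwoSidedIdeal.mem_mk' _ _ _ _ _ _
  let I : TwoSidedIdeal A := TwoSidedIdeal.mk' {a | ∀ b ∈ J, a * b ∈ P}
    (fun b _ => by simp)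
    (fun ha ha' b hb => by rw [add_mul]; exact P.add_mem (ha b hb) (ha' b hb))
    (fun ha b hb => by rw [neg_mul]; exact P.neg_mem (ha b hb))
    (fun {c a} ha b hb => by rw [mul_assoc]; exact P.mul_mem_left _ _ (ha b hb))
    (fun {a c} ha b hb => by rw [mul_assoc]; exact ha _ (J.mul_mem_left _ _ hb))
  have hI : ∀ a, a ∈ I ↔ ∀ b ∈ J, a * b ∈ P := TwoSidedIdeal.mem_mk' _ _ _ _ _ _
  rcases hP.2 I J (fun a ha => (hI a).1 ha) with h | h
  · exact Or.inl (h ((hI x).2 fun b hb => by simpa using (hJ b).1 hb 1))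
  · exact Or.inr (h ((hJ y).2 hxy))

/-- An element outside a homogeneous ideal has a component of highest degree outside the ideal. -/
theorem Grading.exists_leading (h : Grading Γ D) {P : TwoSidedIdeal A} {a : A} (ha : a ∉ P) :
    ∃ m, (Γ a).coeff m ∉ P ∧ ∀ i, m < i → (Γ a).coeff i ∈ P := by
  classical
  let S := (Finset.range ((Γ a).natDegree + 1)).filter fun i => (Γ a).coeff i ∉ P
  have hS : S.Nonempty := by
    by_contra hS
    apply ha
    rw [← h.sum_coeff (a := a) le_rfl]
    refine sum_mem fun i hi => ?_
    by_contra hi'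
    exact hS ⟨i, Finset.mem_filter.2 ⟨hi, hi'⟩⟩
  refine ⟨S.max' hS, (Finset.mem_filter.1 (S.max'_mem hS)).2, fun i hi => ?_⟩
  by_contra hi'
  have hiS : i ∈ S := by
    refine Finset.mem_filter.2 ⟨Finset.mem_range.2 (Nat.lt_succ_of_le ?_), hi'⟩
    apply le_natDegree_of_ne_zero
    intro h0
    exact hi' (h0 ▸ P.zero_mem)
  exact (S.le_max' i hiS).not_gt hi

/-- A homogeneous ideal that is prime for homogeneous elements is prime. -/
theorem Grading.isPrimeIdeal_of_homogeneous (h : Grading Γ D) {P : TwoSidedIdeal A}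
    (hP : IsHomogeneousIdeal Γ P) (hne : P ≠ ⊤)
    (hprime : ∀ a b, (∀ c, (∃ s, Γ c = monomial s c) → a * c * b ∈ P) →
      (∃ m, Γ a = monomial m a) → (∃ l, Γ b = monomial l b) → a ∈ P ∨ b ∈ P) :
    IsPrimeIdeal P := by
  refine ⟨hne, fun I J hIJ => ?_⟩
  by_contra! hcon
  obtain ⟨hI, hJ⟩ := hcon
  obtain ⟨a, haI, haP⟩ := SetLike.not_le_iff_exists.1 hI
  obtain ⟨b, hbJ, hbP⟩ := SetLike.not_le_iff_exists.1 hJ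
  obtain ⟨m, hm, hm'⟩ := h.exists_leading haP
  obtain ⟨l, hl, hl'⟩ := h.exists_leading hbP
  refine (hprime ((Γ a).coeff m) ((Γ b).coeff l) ?_ ⟨m, h.coassoc a m⟩ ⟨l, h.coassoc b l⟩).elim
    hm hl
  rintro c ⟨s, hc⟩
  -- Modulo `P` this component is the product of the leading components with `c` between them: any
  -- other pair of degrees with the same total exceeds `m` on the left or `l` on the right.
  have hmem : (Γ (a * c * b)).coeff (m + s + l) ∈ P :=
    hP _ (hIJ _ (I.mul_mem_right _ _ haI) _ hbJ) _
  have hac : ∀ i, (Γ (a * c)).coeff (i + s) = (Γ a).coeff i * c := fun i => by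
    rw [map_mul, hc, coeff_mul_monomial]
  have hac0 : ∀ i, i < s → (Γ (a * c)).coeff i = 0 := fun i hi => by
    rw [map_mul, hc, ← C_mul_X_pow_eq_monomial, ← mul_assoc, coeff_mul_X_pow', if_neg hi.not_ge]
  rw [map_mul, coeff_mul,
    ← Finset.add_sum_erase _ _
      (Finset.HasAntidiagonal.mem_antidiagonal.2 (rfl : ((m + s, l) : ℕ × ℕ).1 + _ = m + s + l)),
    hac] at hmem
  have hrest : ∑ x ∈ (Finset.HasAntidiagonal.antidiagonal (m + s + l)).erase (m + s, l),
      (Γ (a * c)).coeff x.1 * (Γ b).coeff x.2 ∈ P := by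
    refine sum_mem fun x hx => ?_
    obtain ⟨hx1, hx2⟩ := Finset.mem_erase.1 hx
    rw [Finset.HasAntidiagonal.mem_antidiagonal] at hx2
    rcases lt_or_ge l x.2 with h1 | h1
    · exact P.mul_mem_left _ _ (hl' _ h1)
    · rcases lt_or_ge x.1 s with h2 | h2
      · rw [hac0 _ h2, zero_mul]
        exact P.zero_mem
      · obtain ⟨i, hi⟩ := Nat.exists_eq_add_of_le' h2
        have : m < i := by
          by_contra! hle
          exact hx1 (Prod.ext (by simp; omega) (by simp; omega))
        rw [hi, hac]
        exact P.mul_mem_right _ _ (P.mul_mem_right _ _ (hm' i this))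
  exact (add_mem_cancel_right hrest).1 hmem

end

/-! ### The grading of `O_q(M_n(k))` by the degree in the first row -/

/-- All monomials of a relation use the same two rows, so the relations are homogeneous for any
degree depending only on the row. -/
theorem isQuantumMatrix_monomial {k A : Type*} [Field k] [Ring A] [Algebra k A] {q : k} {n : ℕ}
    {x : Fin n → Fin n → A} (hx : IsQuantumMatrix q x) (d : Fin n → ℕ) :
    IsQuantumMatrix q fun i j => monomial (d i) (x i j) where
  col i l j h := by
    rw [monomial_mul_monomial, monomial_mul_monomial, hx.col j h, smul_monomial, add_comm]
  row i j m h := by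
    rw [monomial_mul_monomial, monomial_mul_monomial, hx.row i h, smul_monomial]
  anti i l j m h h' := by
    rw [monomial_mul_monomial, monomial_mul_monomial, hx.anti h h', add_comm]
  diag i l j m h h' := by
    rw [monomial_mul_monomial, monomial_mul_monomial, monomial_mul_monomial, hx.diag h h',
      smul_monomial, map_add, add_comm (d i)]

theorem ofFn_monomial_prod {A : Type*} [Ring A] {n : ℕ} (d : Fin n → ℕ) (x : Fin n → A) :
    (List.ofFn fun i => monomial (d i) (x i)).prod = monomial (∑ i, d i) (List.ofFn x).prod := by
  induction n with
  | zero => simp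
  | succ n ih =>
    rw [List.ofFn_succ, List.prod_cons, ih, List.ofFn_succ, List.prod_cons, Fin.sum_univ_succ,
      monomial_mul_monomial]

variable {k : Type*} [Field k]

/-- The coaction recording the degree in the generators of the first row. -/
def rowDegree (q : k) (n : ℕ) : OqM q (n + 1) →ₐ[k] (OqM q (n + 1))[X] :=
  (isQuantumMatrix_monomial (isQuantumMatrix_X q (n + 1)) fun i => if i = 0 then 1 else 0).lift

theorem rowDegree_X (q : k) (n : ℕ) (i j : Fin (n + 1)) :
    rowDegree q n (X q (n + 1) i j) = monomial (if i = 0 then 1 else 0) (X q (n + 1) i j) :=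
  IsQuantumMatrix.lift_X _ i j

theorem rowDegree_qdet (q : k) (n : ℕ) :
    rowDegree q n (qdet q (n + 1)) = monomial 1 (qdet q (n + 1)) := by
  rw [rowDegree, IsQuantumMatrix.lift_qdet]
  simp only [ofFn_monomial_prod, smul_monomial, qdet, map_sum]
  simp

/-- Rescaling the first row by `t`. -/
def rowTorus (k : Type*) [Field k] (n : ℕ) (t : kˣ) : Torus k (n + 1) :=
  (fun i => if i = 0 then t else 1, 1)

/-- This ties the grading to the torus: `t = 1` shows that the components of an element sum to it,
and `t = q` separates the components. -/
theorem torusAction_rowTorus (q : k) (n : ℕ) (t : kˣ) (a : OqM q (n + 1)) :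
    torusAction q (n + 1) (rowTorus k n t) a
      = (rowDegree q n a).eval (algebraMap k (OqM q (n + 1)) t) := by
  let f : (OqM q (n + 1))[X] →ₐ[k] OqM q (n + 1) :=
    eval₂AlgHom (AlgHom.id k _) (algebraMap k _ (t : k)) fun a => (Algebra.commutes _ _).symm
  have h : (torusAction q (n + 1) (rowTorus k n t) : OqM q (n + 1) →ₐ[k] OqM q (n + 1))
      = f.comp (rowDegree q n) := by
    refine OqM_hom_ext q (n + 1) fun i j => ?_
    change torusAction q (n + 1) (rowTorus k n t) (X q (n + 1) i j)
      = (rowDegree q n (X q (n + 1) i j)).eval (algebraMap k (OqM q (n + 1)) t)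
    rw [torusAction_X, rowDegree_X, eval_monomial, rowTorus]
    by_cases hi : i = 0
    · simp [hi, Algebra.smul_def, Algebra.commutes]
    · simp [hi]
  exact DFunLike.congr_fun h a

theorem grading_rowDegree {q : k} (hq0 : q ≠ 0) (n : ℕ) :
    Grading (rowDegree q n) (qdet q (n + 1)) where
  eval a := by
    have h1 : rowTorus k n 1 = 1 := by
      ext <;> simp [rowTorus]
    have := torusAction_rowTorus q n 1 a
    rw [h1, map_one] at this
    simpa using this.symm
  coassoc a := by
    induction a using OqM_induction with
    | hc c =>
      intro m
      rw [AlgHom.commutes, Polynomial.algebraMap_apply, coeff_C]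
      split_ifs with h
      · rw [AlgHom.commutes, h]
        rfl
      · simp
    | hX i j =>
      intro m
      rw [rowDegree_X, coeff_monomial]
      by_cases h : (if i = 0 then 1 else 0) = m
      · rw [if_pos h, rowDegree_X, h]
      · rw [if_neg h, map_zero, map_zero]
    | hadd x y hx hy =>
      intro m
      rw [map_add, coeff_add, map_add, hx, hy, map_add]
    | hmul x y hx hy =>
      intro m
      rw [map_mul, coeff_mul, map_sum, map_sum]
      refine Finset.sum_congr rfl fun p hp => ?_
      rw [map_mul, hx, hy, monomial_mul_monomial, Finset.HasAntidiagonal.mem_antidiagonal.1 hp]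
  central := commute_qdet hq0
  map_D := rowDegree_qdet q n

theorem coeff_rowDegree_torusAction (q : k) (n : ℕ) (h : Torus k (n + 1)) (a : OqM q (n + 1))
    (m : ℕ) : (rowDegree q n (torusAction q (n + 1) h a)).coeff m
      = torusAction q (n + 1) h ((rowDegree q n a).coeff m) := by
  let f : OqM q (n + 1) →ₐ[k] OqM q (n + 1) := torusAction q (n + 1) h
  have hf : (rowDegree q n).comp f = (mapAlgHom f).comp (rowDegree q n) := by
    refine OqM_hom_ext q (n + 1) fun i j => ?_
    change rowDegree q n (torusAction q (n + 1) h (X q (n + 1) i j))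
      = Polynomial.map (f : OqM q (n + 1) →+* OqM q (n + 1)) (rowDegree q n (X q (n + 1) i j))
    rw [torusAction_X, map_smul, rowDegree_X, map_monomial, smul_monomial]
    congr 1
    exact (torusAction_X q (n + 1) h i j).symm
  have := congrArg (fun p => p.coeff m) (DFunLike.congr_fun hf a)
  exact this.trans (coeff_map _ _)

theorem torusAction_rowTorus_of_homogeneous {q : k} {n m : ℕ} (t : kˣ) {a : OqM q (n + 1)}
    (ha : rowDegree q n a = monomial m a) :
    torusAction q (n + 1) (rowTorus k n t) a = (t : k) ^ m • a := by
  rw [torusAction_rowTorus, ha, eval_monomial, ← map_pow, ← Algebra.commutes, Algebra.smul_def]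

theorem smul_mem_twoSidedIdeal {A : Type*} [Ring A] [Algebra k A] (P : TwoSidedIdeal A) (c : k)
    {a : A} (ha : a ∈ P) : c • a ∈ P := by
  rw [Algebra.smul_def]
  exact P.mul_mem_left _ _ ha

/-- An ideal stable under an endomorphism contains the eigenvector components of its elements. -/
theorem mem_of_sum_eigenvectors_mem {A : Type*} [Ring A] [Algebra k A] {P : TwoSidedIdeal A}
    (f : A →ₐ[k] A) (hf : ∀ a ∈ P, f a ∈ P) {μ : ℕ → k} (hμ : Function.Injective μ) (s : Finset ℕ)
    (v : ℕ → A) (hv : ∀ i, f (v i) = μ i • v i) (hs : ∑ i ∈ s, v i ∈ P) : ∀ i ∈ s, v i ∈ P := by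
  induction s using Finset.induction_on generalizing v with
  | empty => simp
  | insert j s hj ih =>
    -- Applying `f - μ j` kills the component `v j` and multiplies the others by nonzero scalars.
    have h1 : ∑ i ∈ s, (μ i - μ j) • v i ∈ P := by
      have h2 := P.sub_mem (hf _ hs) (smul_mem_twoSidedIdeal P (μ j) hs)
      rw [map_sum, Finset.smul_sum, ← Finset.sum_sub_distrib, Finset.sum_insert hj] at h2
      simpa [hv, ← sub_smul] using h2
    have h3 : ∀ i ∈ s, v i ∈ P := by
      intro i hi
      have h4 := smul_mem_twoSidedIdeal P (μ i - μ j)⁻¹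
        (ih (fun i => (μ i - μ j) • v i) (fun i => by rw [map_smul, hv, smul_comm]) h1 i hi)
      have h5 : μ i - μ j ≠ 0 := sub_ne_zero.2 fun h => hj (hμ h ▸ hi)
      rwa [smul_smul, inv_mul_cancel₀ h5, one_smul] at h4
    intro i hi
    rcases Finset.mem_insert.1 hi with rfl | hi
    · rw [Finset.sum_insert hj] at hs
      exact (add_mem_cancel_right (sum_mem h3)).1 hs
    · exact h3 i hi

theorem pow_injective_of_not_root_of_unity {q : k} (hq0 : q ≠ 0)
    (hq : ∀ m : ℕ, 0 < m → q ^ m ≠ 1) : Function.Injective fun m : ℕ => q ^ m := by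
  intro a b hab
  by_contra hne
  wlog hlt : a < b generalizing a b
  · exact this hab.symm (Ne.symm hne) (by omega)
  refine hq (b - a) (by omega) ?_
  have h : q ^ a * q ^ (b - a) = q ^ a * 1 := by
    rw [← pow_add, Nat.add_sub_cancel' hlt.le, mul_one]
    exact hab.symm
  exact mul_left_cancel₀ (pow_ne_zero a hq0) h

theorem isHomogeneousIdeal_of_isStable {q : k} (hq0 : q ≠ 0) (hq : ∀ m : ℕ, 0 < m → q ^ m ≠ 1)
    {n : ℕ} {P : TwoSidedIdeal (OqM q (n + 1))} (hP : IsStable (torusAction q (n + 1)) P) :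
    IsHomogeneousIdeal (rowDegree q n) P := by
  intro a ha m
  have hG := grading_rowDegree hq0 n
  by_cases hm : m ≤ (rowDegree q n a).natDegree
  · refine mem_of_sum_eigenvectors_mem
      (torusAction q (n + 1) (rowTorus k n (Units.mk0 q hq0)) : _ →ₐ[k] _) (hP _)
      (pow_injective_of_not_root_of_unity hq0 hq)
      (Finset.range ((rowDegree q n a).natDegree + 1)) (fun i => (rowDegree q n a).coeff i) ?_ ?_ m
      (Finset.mem_range.2 (Nat.lt_succ_of_le hm))
    · exact fun i => torusAction_rowTorus_of_homogeneous _ (hG.coassoc a i)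
    · rwa [hG.sum_coeff le_rfl]
  · rw [coeff_eq_zero_of_natDegree_lt (not_le.1 hm)]
    exact P.zero_mem

/-! ### The quotient map -/

theorem quotMap_qdet (q : k) (n : ℕ) : quotMap q n (qdet q n) = 1 := by
  have h : quotMap q n (qdet q n) = quotMap q n 1 := by
    refine Quotient.sound ?_
    exact (TwoSidedIdeal.rel_iff _ _ _).2 (TwoSidedIdeal.subset_span rfl)
  rw [h, map_one]

/-- Since `D_q - 1` is central, its multiples on one side already form a two-sided ideal. -/
theorem exists_of_quotMap_eq_zero {q : k} (hq0 : q ≠ 0) {n : ℕ} {a : OqM q n}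
    (ha : quotMap q n a = 0) : ∃ c, a = (qdet q n - 1) * c := by
  have hcomm : ∀ x, Commute (qdet q n - 1) x := fun x =>
    (commute_qdet hq0 x).sub_left (Commute.one_left x)
  let K : TwoSidedIdeal (OqM q n) := TwoSidedIdeal.mk' {a | ∃ c, a = (qdet q n - 1) * c}
    ⟨0, by simp⟩
    (by rintro _ _ ⟨c, rfl⟩ ⟨d, rfl⟩; exact ⟨c + d, by rw [mul_add]⟩)
    (by rintro _ ⟨c, rfl⟩; exact ⟨-c, by rw [mul_neg]⟩)
    (by rintro x _ ⟨c, rfl⟩; exact ⟨x * c, by rw [← mul_assoc, ← mul_assoc, (hcomm x).eq]⟩)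
    (by rintro _ x ⟨c, rfl⟩; exact ⟨c * x, by rw [mul_assoc]⟩)
  have hK : ∀ a, a ∈ K ↔ ∃ c, a = (qdet q n - 1) * c := TwoSidedIdeal.mem_mk' _ _ _ _ _ _
  have hle : TwoSidedIdeal.span {qdet q n - 1} ≤ K := by
    rw [TwoSidedIdeal.span_le, Set.singleton_subset_iff]
    exact (hK _).2 ⟨1, by rw [mul_one]⟩
  refine (hK a).1 (hle ?_)
  rw [TwoSidedIdeal.mem_iff]
  exact Quotient.exact (ha.trans (map_zero (quotMap q n)).symm)

theorem imageIdeal_mono {q : k} {n : ℕ} {P P' : TwoSidedIdeal (OqM q n)} (h : P ≤ P') :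
    imageIdeal q n P ≤ imageIdeal q n P' := by
  intro x hx
  rw [mem_imageIdeal] at *
  obtain ⟨a, ha, hax⟩ := hx
  exact ⟨a, h ha, hax⟩

theorem imageIdeal_top (q : k) (n : ℕ) : imageIdeal q n ⊤ = ⊤ := by
  rw [eq_top_iff]
  intro x _
  obtain ⟨a, rfl⟩ := quotMap_surjective q n x
  exact (mem_imageIdeal q n _ _).2 ⟨a, trivial, rfl⟩

theorem mul_mem_imageIdeal {q : k} {n : ℕ} {I J P : TwoSidedIdeal (OqM q n)}
    (hIJ : ∀ a ∈ I, ∀ b ∈ J, a * b ∈ P) :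
    ∀ a ∈ imageIdeal q n I, ∀ b ∈ imageIdeal q n J, a * b ∈ imageIdeal q n P := by
  intro x hx y hy
  rw [mem_imageIdeal] at *
  obtain ⟨a, ha, rfl⟩ := hx
  obtain ⟨b, hb, rfl⟩ := hy
  exact ⟨a * b, hIJ a ha b hb, map_mul _ _ _⟩

theorem isStable_imageIdeal {q : k} {n : ℕ} {P : TwoSidedIdeal (OqM q n)}
    (hP : IsStable (torusAction q n) P) : IsStable (slTorusAction q n) (imageIdeal q n P) := by
  intro g x hx
  rw [mem_imageIdeal] at *
  obtain ⟨a, ha, rfl⟩ := hx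
  exact ⟨_, hP g a ha, (slTorusAction_quotMap q n g a).symm⟩

theorem IsPrimeIdeal.isGPrime {A G : Type*} [Ring A] [Algebra k A] [Group G]
    {φ : G →* (A ≃ₐ[k] A)} {P : TwoSidedIdeal A} (hP : IsPrimeIdeal P) (hs : IsStable φ P) :
    IsGPrime φ P :=
  ⟨hP.1, hs, fun I J _ _ => hP.2 I J⟩

/-- Multiplication by `D_q` is injective modulo an `H`-prime ideal not containing `D_q`. -/
theorem IsGPrime.mem_of_qdet_mul_mem {q : k} (hq0 : q ≠ 0) {n : ℕ} {P : TwoSidedIdeal (OqM q n)}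
    (hP : IsGPrime (torusAction q n) P) (hD : qdet q n ∉ P) {a : OqM q n}
    (ha : qdet q n * a ∈ P) : a ∈ P := by
  have hcomm := commute_qdet hq0 (n := n)
  -- `I` is generated by `D_q` and `J` is the colon ideal of `P` by `D_q`. Both are `H`-stable
  -- because `D_q` is an eigenvector of the torus, and `I * J ⊆ P`.
  let I : TwoSidedIdeal (OqM q n) := TwoSidedIdeal.mk' {a | ∃ c, a = c * qdet q n}
    ⟨0, by simp⟩
    (by rintro _ _ ⟨c, rfl⟩ ⟨d, rfl⟩; exact ⟨c + d, by rw [add_mul]⟩)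
    (by rintro _ ⟨c, rfl⟩; exact ⟨-c, by rw [neg_mul]⟩)
    (by rintro x _ ⟨c, rfl⟩; exact ⟨x * c, by rw [mul_assoc]⟩)
    (by rintro _ x ⟨c, rfl⟩; exact ⟨c * x, by rw [mul_assoc, mul_assoc, (hcomm x).eq]⟩)
  have hI : ∀ a, a ∈ I ↔ ∃ c, a = c * qdet q n := TwoSidedIdeal.mem_mk' _ _ _ _ _ _
  let J : TwoSidedIdeal (OqM q n) := TwoSidedIdeal.mk' {b | qdet q n * b ∈ P}
    (by simp)
    (fun hb hb' => by
      rw [Set.mem_ofPred_eq, mul_add]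
      exact P.add_mem hb hb')
    (fun hb => by
      rw [Set.mem_ofPred_eq, mul_neg]
      exact P.neg_mem hb)
    (fun {x y} hy => by
      rw [Set.mem_ofPred_eq, ← mul_assoc, (hcomm x).eq, mul_assoc]
      exact P.mul_mem_left _ _ hy)
    (fun {x y} hx => by
      rw [Set.mem_ofPred_eq, ← mul_assoc]
      exact P.mul_mem_right _ _ hx)
  have hJ : ∀ b, b ∈ J ↔ qdet q n * b ∈ P := TwoSidedIdeal.mem_mk' _ _ _ _ _ _
  have hIs : IsStable (torusAction q n) I := by
    intro g x hx
    rw [hI] at *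
    obtain ⟨c, rfl⟩ := hx
    rw [map_mul, torusAction_qdet, mul_smul_comm, ← smul_mul_assoc]
    exact ⟨_, rfl⟩
  have hJs : IsStable (torusAction q n) J := by
    intro g b hb
    rw [hJ] at *
    have h := hP.2.1 g _ hb
    rw [map_mul, torusAction_qdet, smul_mul_assoc] at h
    have h' := smul_mem_twoSidedIdeal P (((∏ i, g.1 i) * ∏ j, g.2 j : kˣ) : k)⁻¹ h
    rwa [smul_smul, inv_mul_cancel₀ (Units.ne_zero _), one_smul] at h'
  rcases hP.2.2 I J hIs hJs (fun x hx b hb => by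
    obtain ⟨c, rfl⟩ := (hI x).1 hx
    rw [mul_assoc]
    exact P.mul_mem_left _ _ ((hJ b).1 hb)) with h | h
  · exact absurd (h ((hI _).2 ⟨1, by rw [one_mul]⟩)) hD
  · exact h ((hJ a).2 ha)

/-! ### The bijections -/

/-- The two bijections, from a multiplicative section `L` of the image map. -/
theorem bijOn_imageIdeal {q : k} {n : ℕ} {L : TwoSidedIdeal (OqSL q n) → TwoSidedIdeal (OqM q n)}
    (image_L : ∀ Q, imageIdeal q n (L Q) = Q)
    (L_image : ∀ P, IsGPrime (torusAction q n) P → qdet q n ∉ P → L (imageIdeal q n P) = P)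
    (le_L_image : ∀ P, IsStable (torusAction q n) P → P ≤ L (imageIdeal q n P))
    (L_mono : ∀ Q Q', Q ≤ Q' → L Q ≤ L Q')
    (L_mul : ∀ I J Q : TwoSidedIdeal (OqSL q n), (∀ a ∈ I, ∀ b ∈ J, a * b ∈ Q) →
      ∀ a ∈ L I, ∀ b ∈ L J, a * b ∈ L Q)
    (L_stable : ∀ Q, IsStable (slTorusAction q n) Q → IsStable (torusAction q n) (L Q))
    (L_prime : ∀ Q, IsPrimeIdeal Q → IsPrimeIdeal (L Q)) :
    Set.BijOn (imageIdeal q n)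
      {P : TwoSidedIdeal (OqM q n) | IsGPrime (torusAction q n) P ∧ qdet q n ∉ P}
      {Q : TwoSidedIdeal (OqSL q n) | IsGPrime (slTorusAction q n) Q} ∧
    Set.BijOn (imageIdeal q n)
      {P : TwoSidedIdeal (OqM q n) |
        (IsPrimeIdeal P ∧ IsStable (torusAction q n) P) ∧ qdet q n ∉ P}
      {Q : TwoSidedIdeal (OqSL q n) | IsPrimeIdeal Q ∧ IsStable (slTorusAction q n) Q} := by
  have image_ne_top : ∀ P, IsGPrime (torusAction q n) P → qdet q n ∉ P →
      imageIdeal q n P ≠ ⊤ := by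
    intro P hP hD htop
    apply hP.1
    rw [eq_top_iff, ← L_image P hP hD, htop]
    refine (le_L_image ⊤ fun _ _ _ => trivial).trans_eq ?_
    rw [imageIdeal_top]
  -- As `π` sends `D_q` to `1`, having `D_q` in the lift would put `1` in `Q`.
  have qdet_notMem : ∀ Q, Q ≠ ⊤ → qdet q n ∉ L Q := by
    intro Q hQ hD
    apply hQ
    rw [eq_top_iff]
    intro x _
    have h1 : (1 : OqSL q n) ∈ Q := by
      rw [← image_L Q, mem_imageIdeal]
      exact ⟨_, hD, quotMap_qdet q n⟩
    simpa using Q.mul_mem_left x 1 h1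
  have le_of_L_le : ∀ P I, L I ≤ P → I ≤ imageIdeal q n P := by
    intro P I hI
    rw [← image_L I]
    exact imageIdeal_mono hI
  have L_mul' : ∀ P, IsGPrime (torusAction q n) P → qdet q n ∉ P → ∀ I J,
      (∀ a ∈ I, ∀ b ∈ J, a * b ∈ imageIdeal q n P) → ∀ a ∈ L I, ∀ b ∈ L J, a * b ∈ P := by
    intro P hP hD I J hIJ
    have := L_mul I J _ hIJ
    rwa [L_image P hP hD] at this
  refine ⟨⟨?_, ?_, ?_⟩, ⟨?_, ?_, ?_⟩⟩
  · rintro P ⟨hP, hD⟩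
    exact ⟨image_ne_top P hP hD, isStable_imageIdeal hP.2.1, fun I J hI hJ hIJ =>
      (hP.2.2 _ _ (L_stable I hI) (L_stable J hJ) (L_mul' P hP hD I J hIJ)).imp
        (le_of_L_le P I) (le_of_L_le P J)⟩
  · rintro P ⟨hP, hD⟩ P' ⟨hP', hD'⟩ h
    rw [← L_image P hP hD, h, L_image P' hP' hD']
  · intro Q hQ
    refine ⟨L Q, ⟨⟨?_, L_stable Q hQ.2.1, ?_⟩, qdet_notMem Q hQ.1⟩, image_L Q⟩
    · intro h
      apply hQ.1
      rw [← image_L Q, h, imageIdeal_top]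
    · intro I J hI hJ hIJ
      have := mul_mem_imageIdeal hIJ
      rw [image_L] at this
      exact (hQ.2.2 _ _ (isStable_imageIdeal hI) (isStable_imageIdeal hJ) this).imp
        (fun h => (le_L_image I hI).trans (L_mono _ _ h))
        (fun h => (le_L_image J hJ).trans (L_mono _ _ h))
  · rintro P ⟨⟨hP, hs⟩, hD⟩
    have hG := hP.isGPrime hs
    exact ⟨⟨image_ne_top P hG hD, fun I J hIJ => (hP.2 _ _ (L_mul' P hG hD I J hIJ)).imp
      (le_of_L_le P I) (le_of_L_le P J)⟩, isStable_imageIdeal hs⟩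
  · rintro P ⟨⟨hP, hs⟩, hD⟩ P' ⟨⟨hP', hs'⟩, hD'⟩ h
    rw [← L_image P (hP.isGPrime hs) hD, h, L_image P' (hP'.isGPrime hs') hD']
  · rintro Q ⟨hQ, hs⟩
    exact ⟨L Q, ⟨⟨L_prime Q hQ, L_stable Q hs⟩, qdet_notMem Q hQ.1⟩, image_L Q⟩

theorem isStable_liftIdeal {q : k} (hq0 : q ≠ 0) {n : ℕ} {Q : TwoSidedIdeal (OqSL q (n + 1))}
    (hQ : IsStable (slTorusAction q (n + 1)) Q) :
    IsStable (torusAction q (n + 1)) (liftIdeal (rowDegree q n) (quotMap q (n + 1)) Q) := by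
  intro g a ha
  rw [mem_liftIdeal] at *
  intro m
  -- Dividing `g` by the rescaling of the first row by `t` lands in `SH`; the rescaling itself acts
  -- on each component by a scalar.
  let t : kˣ := (∏ i, g.1 i) * ∏ j, g.2 j
  have hs : g * (rowTorus k n t)⁻¹ ∈ specialTorus k (n + 1) := by
    change (∏ i, g.1 i * (if i = 0 then t else 1)⁻¹) * (∏ j, g.2 j * (1 : kˣ)⁻¹) = 1
    rw [Finset.prod_mul_distrib, Finset.prod_inv_distrib, Finset.prod_ite_eq' Finset.univ]
    simp only [Finset.mem_univ, if_true, inv_one, mul_one]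
    rw [mul_right_comm]
    exact mul_inv_cancel t
  have hg : torusAction q (n + 1) g = torusAction q (n + 1) (g * (rowTorus k n t)⁻¹)
      * torusAction q (n + 1) (rowTorus k n t) := by
    rw [← map_mul, inv_mul_cancel_right]
  rw [coeff_rowDegree_torusAction, hg, AlgEquiv.mul_apply,
    torusAction_rowTorus_of_homogeneous _ ((grading_rowDegree hq0 n).coassoc a m), map_smul,
    map_smul]
  exact smul_mem_twoSidedIdeal Q _ (hQ ⟨_, hs⟩ _ (ha m))

/-- It suffices to test homogeneous elements, whose membership is decided by their images; every
element of the quotient is a sum of images of homogeneous elements. -/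
theorem isPrimeIdeal_liftIdeal {q : k} (hq0 : q ≠ 0) {n : ℕ} {Q : TwoSidedIdeal (OqSL q (n + 1))}
    (hQ : IsPrimeIdeal Q) :
    IsPrimeIdeal (liftIdeal (rowDegree q n) (quotMap q (n + 1)) Q) := by
  have hG := grading_rowDegree hq0 n
  refine hG.isPrimeIdeal_of_homogeneous (hG.isHomogeneousIdeal_liftIdeal Q) ?_ ?_
  · intro htop
    apply hQ.1
    rw [eq_top_iff]
    intro x _
    obtain ⟨a, rfl⟩ := quotMap_surjective q (n + 1) x
    exact hG.map_mem_of_mem_liftIdeal (htop ▸ trivial)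
  · rintro a b hab ⟨m, ha⟩ ⟨l, hb⟩
    rw [mem_liftIdeal_of_homogeneous ha, mem_liftIdeal_of_homogeneous hb]
    refine hQ.mem_or_mem fun x => ?_
    obtain ⟨c, rfl⟩ := quotMap_surjective q (n + 1) x
    rw [← hG.sum_coeff (a := c) le_rfl, map_sum, Finset.mul_sum, Finset.sum_mul]
    refine sum_mem fun i _ => ?_
    rw [← map_mul, ← map_mul]
    exact hG.map_mem_of_mem_liftIdeal (hab _ ⟨i, hG.coassoc c i⟩)

theorem qdet_zero (q : k) : qdet q 0 = 1 := by
  simp [qdet, permLength_eq_card_inversions, Finset.eq_empty_of_isEmpty]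

end QuantumMatrix

end

open QuantumMatrix in
theorem corollary2p5 {k : Type*} [Field k] (q : k) (hq0 : q ≠ 0)
    (hq : ∀ m : ℕ, 0 < m → q ^ m ≠ 1) (n : ℕ) :
    Set.BijOn (imageIdeal q n)
      {P : TwoSidedIdeal (OqM q n) | IsGPrime (torusAction q n) P ∧ qdet q n ∉ P}
      {Q : TwoSidedIdeal (OqSL q n) | IsGPrime (slTorusAction q n) Q} ∧
    Set.BijOn (imageIdeal q n)
      {P : TwoSidedIdeal (OqM q n) |
        (IsPrimeIdeal P ∧ IsStable (torusAction q n) P) ∧ qdet q n ∉ P}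
      {Q : TwoSidedIdeal (OqSL q n) | IsPrimeIdeal Q ∧ IsStable (slTorusAction q n) Q} := by
  cases n with
  | zero =>
    -- For `n = 0` there is no first row to grade by, but `D_q = 1`, so `π` is injective and the
    -- preimage serves as the section; the torus is trivial.
    have hinj : Function.Injective (quotMap q 0) := by
      rw [injective_iff_map_eq_zero]
      intro a ha
      obtain ⟨c, rfl⟩ := exists_of_quotMap_eq_zero hq0 ha
      rw [qdet_zero, sub_self, zero_mul]
    have hmem : ∀ (P : TwoSidedIdeal (OqM q 0)) (a), quotMap q 0 a ∈ imageIdeal q 0 P ↔ a ∈ P := by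
      intro P a
      rw [mem_imageIdeal]
      exact ⟨fun ⟨b, hb, h⟩ => hinj h ▸ hb, fun h => ⟨a, h, rfl⟩⟩
    have hcomap : ∀ (Q : TwoSidedIdeal (OqSL q 0)) (a),
        a ∈ TwoSidedIdeal.comap (quotMap q 0) Q ↔ quotMap q 0 a ∈ Q := fun Q a =>
      TwoSidedIdeal.mem_comap (quotMap q 0)
    have himage : ∀ Q : TwoSidedIdeal (OqSL q 0),
        imageIdeal q 0 (TwoSidedIdeal.comap (quotMap q 0) Q) = Q := by
      intro Q
      ext x
      obtain ⟨a, rfl⟩ := quotMap_surjective q 0 x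
      rw [hmem, hcomap]
    have hL : ∀ P : TwoSidedIdeal (OqM q 0),
        TwoSidedIdeal.comap (quotMap q 0) (imageIdeal q 0 P) = P := by
      intro P
      ext a
      rw [hcomap, hmem]
    refine bijOn_imageIdeal (L := fun Q => TwoSidedIdeal.comap (quotMap q 0) Q) himage
      (fun P _ _ => hL P) (fun P _ => (hL P).ge) (fun Q Q' h => TwoSidedIdeal.comap_le_comap _ h)
      (fun I J Q hIJ a ha b hb => ?_) (fun Q _ g a ha => ?_) (fun Q hQ => ⟨fun h => ?_, ?_⟩)
    · rw [hcomap] at *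
      rw [map_mul]
      exact hIJ _ ha _ hb
    · rwa [Subsingleton.elim g 1, map_one]
    · exact hQ.1 (by rw [← himage Q, h, imageIdeal_top])
    · intro I J hIJ
      have := mul_mem_imageIdeal hIJ
      rw [himage] at this
      rw [← hL I, ← hL J]
      exact (hQ.2 _ _ this).imp (fun h => TwoSidedIdeal.comap_le_comap _ h)
        (fun h => TwoSidedIdeal.comap_le_comap _ h)
  | succ n =>
    have hG := grading_rowDegree hq0 n
    have hle : ∀ P, IsHomogeneousIdeal (rowDegree q n) P →
        P ≤ liftIdeal (rowDegree q n) (quotMap q (n + 1)) (imageIdeal q (n + 1) P) := by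
      intro P hP a ha
      rw [mem_liftIdeal]
      exact fun m => (mem_imageIdeal _ _ _ _).2 ⟨_, hP a ha m, rfl⟩
    refine bijOn_imageIdeal (L := liftIdeal (rowDegree q n) (quotMap q (n + 1))) ?_ ?_
      (fun P hP => hle P (isHomogeneousIdeal_of_isStable hq0 hq hP)) (fun _ _ h => liftIdeal_mono h)
      (fun _ _ _ h => mul_mem_liftIdeal h) (fun _ hQ => isStable_liftIdeal hq0 hQ)
      (fun _ hQ => isPrimeIdeal_liftIdeal hq0 hQ)
    · intro Q
      ext x
      rw [mem_imageIdeal]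
      constructor
      · rintro ⟨a, ha, rfl⟩
        exact hG.map_mem_of_mem_liftIdeal ha
      · intro hx
        obtain ⟨a, rfl⟩ := quotMap_surjective q (n + 1) x
        exact hG.exists_mem_liftIdeal (quotMap_qdet q (n + 1)) hx
    · intro P hP hD
      have hh := isHomogeneousIdeal_of_isStable hq0 hq hP.2.1
      refine le_antisymm (fun a ha => ?_) (hle P hh)
      rw [← hG.sum_coeff (a := a) le_rfl]
      refine sum_mem fun i _ => ?_
      -- Each component agrees with some `p ∈ P` modulo `D_q - 1`; being homogeneous, it then lies
      -- in `P` because `D_q` is regular modulo `P`.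
      obtain ⟨p, hp, hpa⟩ := (mem_imageIdeal _ _ _ _).1 (mem_liftIdeal.1 ha i)
      exact hG.mem_of_map_mem (fun a ha => exists_of_quotMap_eq_zero hq0 ha) hh
        (fun a ha => hP.mem_of_qdet_mul_mem hq0 hD ha) (hG.coassoc a i) hp hpa
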